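/- \textbf{Model.} There are $n$ players, an authentic private channel between every two players, and a broadcast channel. Each player has private coins, independent of those of the other players, and there is no other shared randomness. A protocol for messages of $m$ bits sends one bit at a time (privately from a player $i$ to a player $j$, or by broadcast); who sends next, and on which channel, is determined by public information (the steps so far and the bits broadcast so far), there is a bound on the number of steps, and the bit sent depends on what its sender knows. A sender $S$ knows that he is the sender and has a message $w\in\{0,1\}^m$, a receiver $R\neq S$ knows that he is the receiver, and the other players only know that they are neither. The protocol is \emph{correct up to} $\varepsilon$ if, when all players follow it, $R$ outputs $w$ with probability at least $1-\varepsilon$, for all $S\ne R$ and $w$. It is \emph{anonymous} if for every set $C$ of players who follow the protocol and pool their information, the joint distribution of the coins of $C$ and of everything $C$ sees depends only on the inputs of the members of $C$, and on $w$ if $R\in C$; so $C$ learns nothing else about $S$, $R$ and $w$. \textbf{The protocol.} In a round of \emph{parity} with input bits $x_1,\dots,x_n$, each player $i$ chooses a uniformly random $n$-bit string $r_i$ whose parity is $x_i$, sends its bit $r_i^j$ privately to each $j\ne i$, and then broadcasts the parity $z_i$ of $r_i^i$ and of the bits received; the outcome is $z_1\oplus\dots\oplus z_n$. Let $\ell=m+2(\lceil\log_2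 m\rceil+s)$, where $s$ is the security parameter. Let $F$ be a probabilistic encoding of $\{0,1\}^m$ into $\{0,1\}^{\ell}$ and $G:\{0,1\}^{\ell}\to\{0,1\}^m\cup\{\perp\}$ a decoding with $G(F(w))=w$ always, such that for each $w$ and each fixed nonzero $\delta$ one has $G(F(w)\oplus\delta)=\perp$ except with probability at most $2^{-s}$ (an algebraic manipulation detection code). In the \emph{fixed-role anonymous message transmission protocol}, the players execute $\ell$ rounds of parity, where $S$ inputs the bits of $F(w)$, $R$ inputs the bits of a random string $r\in\{0,1\}^{\ell}$, and the others input $0$. From the outcomes $d$ the receiver computes $y=G(d\oplus r)$. Then a veto is executed: for each of $n$ orderings of the players with different last players, there are $s$ rounds of parity with broadcasts in that order, in which $R$ inputs a fresh random bit if $y=\perp$, and all other inputs are $0$. If one of these rounds has outcome $1$ the protocol aborts; otherwise $R$ outputs $y$. \textbf{Theorem.} For a fixed security parameter, the fixed-role anonymous message transmission protocol is asymptotically optimal in communication. Precisely: (1) In every anonymous protocol for $n$ players and $m$-bit messages that is correct up to $\varepsilon$, for all $S\neq R$, all $w$ and all players $i\ne j$, the number of bits exchanged by $i$ and $j$ (in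 both directions together) on their private channel is at least $m$, with probability at least $1-2\varepsilon$ (so almost surely, if the protocol is always correct). (2) Codes $(F,G)$ as above exist for all $m\ge 2$ and all $s\geq 0$. For all $n,m,s$, every such code and all such orderings, the fixed-role anonymous message transmission protocol is anonymous and is correct up to $0$, and in it each player sends exactly $2(\ell+ns)$ bits to each other player (private bits and broadcast bits together) in every execution in which the players follow it, whatever their roles are. (3) For every $s$ there is a constant $K_s$ such that for all $2\le n\le m$, all such codes and orderings, each player sends at most $K_s\, m$ bits to each other player, that is, $O(1)$ bits per message bit. (4) For every $s$ and every $\varepsilon<\frac12$ there is a constant $K_{s,\varepsilon}$ such that for all $2\le n\le m$, all such codes and orderings, all $S\ne R$ and all $w$, the total communication of the protocol (a broadcast counted as one bit to each of the other $n-1$ players) is in every execution at most $K_{s,\varepsilon}$ times the expected total number of private bits of any anonymous protocol for $n$ players and $m$-bit messages that is correct up to $\varepsilon$, with the same $S$, $R$ and $w$. -/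

import Mathlib

open scoped BigOperators

/-! ### Communication model

`n` players, a private authentic channel between every two players, a broadcast channel, and
private independent coins for each player.  Bits are sent one after the other. -/

/-- A bit string of length `m`. -/
abbrev Bits (m : ℕ) := Fin m → Bool

/-- Bitwise exclusive or. -/
def Bits.add {m : ℕ} (a b : Bits m) : Bits m := fun k => xor (a k) (b k)

/-- What a player knows at the beginning: that he is the sender, with message `w`, or that he is
the receiver, or that he is neither. -/
inductive Role (m : ℕ) where
  | sender (w : Bits m)
  | receiver
  | bystander

/-- The role assignment with sender `S`, receiver `R` and message `w`.  Nobody is told the role of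
anybody else. -/
def assign {n m : ℕ} (S R : Fin n) (w : Bits m) : Fin n → Role m := fun i =>
  if i = S then Role.sender w else if i = R then Role.receiver else Role.bystander

/-- The transmission of one bit by `src`: to player `j` on the private channel if `dst = some j`,
by broadcast if `dst = none`.  The number `tag` is a public label (the number of the round). -/
structure Step (n : ℕ) where
  src : Fin n
  dst : Option (Fin n)
  tag : ℕ
  deriving DecidableEq

/-- All transmissions so far, in order, with the transmitted bits. -/
abbrev Transcript (n : ℕ) := List (Step n × Bool)

/-- A transcript in which some bits are hidden. -/
abbrev Seen (n : ℕ) := List (Step n × Option Bool)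

/-- The coalition `C` reads a bit if it is broadcast, or if a member sends or receives it. -/
def Step.VisibleTo {n : ℕ} (C : Finset (Fin n)) (e : Step n) : Prop :=
  e.dst = none ∨ e.src ∈ C ∨ ∃ j ∈ C, e.dst = some j

instance {n : ℕ} (C : Finset (Fin n)) (e : Step n) : Decidable (e.VisibleTo C) :=
  inferInstanceAs (Decidable (e.dst = none ∨ e.src ∈ C ∨ ∃ j ∈ C, e.dst = some j))

/-- What the coalition `C` sees of a transcript.  For `C = ∅` this is the public information. -/
def Transcript.seenBy {n : ℕ} (C : Finset (Fin n)) (τ : Transcript n) : Seen n :=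
  τ.map fun e => (e.1, if e.1.VisibleTo C then some e.2 else none)

/-- Number of bits that `i` sends to `j` on the private channel. -/
def Transcript.privateBits {n : ℕ} (τ : Transcript n) (i j : Fin n) : ℕ :=
  τ.countP fun e => decide (e.1.src = i ∧ e.1.dst = some j)

/-- Number of bits that `i` broadcasts. -/
def Transcript.broadcastBits {n : ℕ} (τ : Transcript n) (i : Fin n) : ℕ :=
  τ.countP fun e => decide (e.1.src = i ∧ e.1.dst = none)

/-- Number of bits that `i` sends to `j`, privately or by broadcast. -/
def Transcript.sentBits {n : ℕ} (τ : Transcript n) (i j : Fin n) : ℕ :=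
  τ.privateBits i j + τ.broadcastBits i

/-- Total number of bits sent on private channels. -/
def Transcript.totalPrivate {n : ℕ} (τ : Transcript n) : ℕ :=
  ∑ i, ∑ j ∈ Finset.univ.erase i, τ.privateBits i j

/-- Total number of bits sent, where a broadcast counts as one bit to each of the other players. -/
def Transcript.totalSent {n : ℕ} (τ : Transcript n) : ℕ :=
  ∑ i, ∑ j ∈ Finset.univ.erase i, τ.sentBits i j

/-- A protocol for `n` players and messages of `m` bits. -/
structure Protocol (n m : ℕ) where
  /-- the coins of player `i` -/
  Coin : Fin n → Type
  [fintypeCoin : ∀ i, Fintype (Coin i)]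
  /-- their distribution; coins of different players are independent -/
  law : ∀ i, PMF (Coin i)
  /-- a bound for the number of steps -/
  steps : ℕ
  /-- the next step, as a function of the public information; `none` ends the protocol -/
  next : Seen n → Option (Step n)
  /-- the bit sent in a step, as a function of what its sender knows -/
  bit : (e : Step n) → Role m → Coin e.src → Seen n → Bool
  /-- the output of the receiver, as a function of what he knows; `none` is abortion -/
  out : (i : Fin n) → Coin i → Seen n → Option (Bits m)

attribute [instance] Protocol.fintypeCoin

namespace Protocol

variable {n m : ℕ} (P : Protocol n m)

/-- The coins of all players. -/
abbrev Coins := ∀ i, P.Coin i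

/-- The transcript after at most `t` steps if all players follow the protocol. -/
def run (inp : Fin n → Role m) (ω : P.Coins) : ℕ → Transcript n
  | 0 => []
  | t + 1 =>
    let τ := run inp ω t
    match P.next (τ.seenBy ∅) with
    | none => τ
    | some e => τ ++ [(e, P.bit e (inp e.src) (ω e.src) (τ.seenBy {e.src}))]

/-- The complete transcript. -/
def transcript (inp : Fin n → Role m) (ω : P.Coins) : Transcript n :=
  P.run inp ω P.steps

/-- The output of player `R`, as receiver. -/
def output (inp : Fin n → Role m) (ω : P.Coins) (R : Fin n) : Option (Bits m) :=
  P.out R (ω R) ((P.transcript inp ω).seenBy {R})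

/-- Expectation over the coins of the players. -/
noncomputable def expect (X : P.Coins → ℝ) : ℝ :=
  ∑ ω : P.Coins, (∏ i, (P.law i (ω i)).toReal) * X ω

open Classical in
/-- Probability over the coins of the players. -/
noncomputable def prob (E : P.Coins → Prop) : ℝ :=
  P.expect fun ω => if E ω then 1 else 0

/-- If all players follow the protocol then the receiver outputs the message of the sender, except
with probability at most `ε`, whoever they are and whatever the message is. -/
def CorrectUpTo (ε : ℝ) : Prop :=
  ∀ (S R : Fin n) (w : Bits m), S ≠ R →
    1 - ε ≤ P.prob fun ω => P.output (assign S R w) ω R = some w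

/-- Perfect privacy and anonymity: the only thing that any coalition `C` can learn is the message,
if the receiver belongs to `C`.  That is, the joint distribution of the coins of `C` and of what
`C` sees is the same for any two situations in which the members of `C` have the same inputs and,
if the receiver is one of them, the message is the same. -/
def Anonymous : Prop :=
  ∀ (C : Finset (Fin n)) (S R S' R' : Fin n) (w w' : Bits m), S ≠ R → S' ≠ R' →
    (∀ i ∈ C, assign S R w i = assign S' R' w' i) → (R ∈ C → w = w') →
    ∀ (c : P.Coins) (v : Seen n),
      (P.prob fun ω => (∀ i ∈ C, ω i = c i) ∧
        (P.transcript (assign S R w) ω).seenBy C = v) =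
      (P.prob fun ω => (∀ i ∈ C, ω i = c i) ∧
        (P.transcript (assign S' R' w') ω).seenBy C = v)

end Protocol

/-! ### Algebraic manipulation detection codes -/

/-- Length of the code words: `m + 2 (log m + s)`, with the binary logarithm rounded up. -/
def amdLength (m s : ℕ) : ℕ := m + 2 * (Nat.clog 2 m + s)

open Classical in
/-- An algebraic manipulation detection code for messages of `m` bits with security parameter `s`:
a probabilistic encoding and a decoding (`none` stands for `⊥`) that inverts it, such that any
fixed nonzero pattern of bit flips is detected except with probability at most `2 ^ (-s)`. -/
structure AMDCode (m s : ℕ) where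
  Coin : Type
  [fintypeCoin : Fintype Coin]
  [nonemptyCoin : Nonempty Coin]
  enc : Bits m → Coin → Bits (amdLength m s)
  dec : Bits (amdLength m s) → Option (Bits m)
  dec_enc : ∀ w c, dec (enc w c) = some w
  detect : ∀ (w : Bits m) (δ : Bits (amdLength m s)), (∃ k, δ k = true) →
    ((Finset.univ.filter fun c => dec ((enc w c).add δ) ≠ none).card : ℝ) / Fintype.card Coin
      ≤ (1 / 2) ^ s

attribute [instance] AMDCode.fintypeCoin AMDCode.nonemptyCoin

/-! ### The fixed role anonymous message transmission protocol -/

namespace FixedRole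

/-- The exclusive or of a family of bits. -/
def parity {n : ℕ} (f : Fin n → Bool) : Bool :=
  (List.finRange n).foldr (fun i b => xor (f i) b) false

/-- The bit with number `k`, as far as there is one. -/
def bitAt {N : ℕ} (f : Bits N) (k : ℕ) : Bool := if h : k < N then f ⟨k, h⟩ else false

/-- The bit that was sent in step `e`. -/
def read {n : ℕ} (v : Seen n) (e : Step n) : Bool :=
  ((v.find? fun x => decide (x.1 = e)).bind fun x => x.2).getD false

/-- The outcome of round `k` of **parity**: the exclusive or of the announced bits. -/
def outcome {n : ℕ} (v : Seen n) (k : ℕ) : Bool := parity fun i => read v ⟨i, none, k⟩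

/-- The steps of round `k` of **parity**: everybody sends a bit to everybody else, then everybody
broadcasts a bit, in the order `π`. -/
def roundSteps {n : ℕ} (k : ℕ) (π : Equiv.Perm (Fin n)) : List (Step n) :=
  ((List.finRange n).flatMap fun i =>
    ((List.finRange n).filter fun j => decide (j ≠ i)).map fun j => ⟨i, some j, k⟩) ++
  (List.finRange n).map fun p => ⟨π p, none, k⟩

variable {n m s : ℕ}

/-- Number of rounds of **parity**: one for each bit of the code word, and, for **veto**, `s` for
each of the `n` orderings of the players. -/
def rounds (n m s : ℕ) : ℕ := amdLength m s + n * s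

/-- All steps of the protocol. -/
def schedule (m s : ℕ) (ord : Fin n → Equiv.Perm (Fin n)) : List (Step n) :=
  ((List.range (amdLength m s)).flatMap fun k => roundSteps k 1) ++
  (List.finRange n).flatMap fun (o : Fin n) => (List.range s).flatMap fun q =>
    roundSteps (amdLength m s + o.val * s + q) (ord o)

/-- The coins of a player. -/
structure Coin (n : ℕ) {m s : ℕ} (code : AMDCode m s) where
  /-- the random strings of the rounds of **parity** -/
  share : Fin (rounds n m s) → Bits n
  /-- the random string of the receiver, then the coin flips for **veto** -/
  pad : Bits (rounds n m s)
  /-- the coins of the encoding -/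
  enc : code.Coin

/-- Coins as triples. -/
def Coin.equiv (n : ℕ) {m s : ℕ} (code : AMDCode m s) :
    Coin n code ≃ (Fin (rounds n m s) → Bits n) × Bits (rounds n m s) × code.Coin where
  toFun c := (c.share, c.pad, c.enc)
  invFun x := ⟨x.1, x.2.1, x.2.2⟩
  left_inv _ := rfl
  right_inv _ := rfl

noncomputable instance (code : AMDCode m s) : Fintype (Coin n code) :=
  Fintype.ofEquiv _ (Coin.equiv n code).symm

instance (code : AMDCode m s) : Nonempty (Coin n code) :=
  ⟨⟨fun _ _ => false, fun _ => false, Classical.arbitrary _⟩⟩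

variable (code : AMDCode m s)

/-- What the receiver decodes: `G (d ⊕ r)`. -/
def decoded (c : Coin n code) (v : Seen n) : Option (Bits m) :=
  code.dec fun k => xor (outcome v k) (bitAt c.pad k)

/-- The input of a player for round `k` of **parity**.  While the code word is transmitted, the
sender uses its bits, the receiver uses random bits, and the others use `0`.  In **veto** the
receiver uses a random bit if he decoded `⊥`, and everybody else uses `0`. -/
def input (k : ℕ) (c : Coin n code) (v : Seen n) : Role m → Bool
  | Role.sender w => bitAt (code.enc w c.enc) k
  | Role.receiver =>
    if k < amdLength m s then bitAt c.pad k
    else if decoded code c v = none then bitAt c.pad k else false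
  | Role.bystander => false

/-- Bit `j` of the random string of player `i` in round `k` of **parity**.  It is uniformly random
among the strings whose parity is the input `x` of the player: all bits but bit `i` are free. -/
def share (k : ℕ) (i : Fin n) (c : Coin n code) (x : Bool) (j : Fin n) : Bool :=
  let r : Bits n := fun j => if h : k < rounds n m s then c.share ⟨k, h⟩ j else false
  if j = i then xor x (parity fun l => if l = i then false else r l) else r j

/-- The bit sent in step `e`: in round `e.tag` of **parity** the player sends to `j` bit `j` of his
random string, and broadcasts the parity of the bits he received and the bit that he kept. -/
def message (e : Step n) (ρ : Role m) (c : Coin n code) (v : Seen n) : Bool :=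
  match e.dst with
  | some j => share code e.tag e.src c (input code e.tag c v ρ) j
  | none => parity fun l =>
      if l = e.src then share code e.tag e.src c (input code e.tag c v ρ) e.src
      else read v ⟨l, some e.src, e.tag⟩

/-- The receiver outputs what he decoded if all rounds of **veto** have outcome `0`. -/
def result (c : Coin n code) (v : Seen n) : Option (Bits m) :=
  if ∃ k < n * s, outcome v (amdLength m s + k) = true then none else decoded code c v

end FixedRole

/-- The fixed role anonymous message transmission protocol for `n` players and `m` bits with
security parameter `s`, with the code `code`, and with the orderings `ord` of the players in
**veto** (in ordering `o`, player `ord o p` is the one who speaks at position `p`). -/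
noncomputable def fixedRoleAMT {n m s : ℕ} (code : AMDCode m s)
    (ord : Fin n → Equiv.Perm (Fin n)) : Protocol n m where
  Coin _ := FixedRole.Coin n code
  law _ := PMF.uniformOfFintype _
  steps := (FixedRole.schedule m s ord).length
  next v := (FixedRole.schedule m s ord)[v.length]?
  bit e ρ c v := FixedRole.message code e ρ c v
  out _ c v := FixedRole.result code c v

/-- The last players of the `n` orderings are different. -/
def DistinctLast {n : ℕ} (ord : Fin n → Equiv.Perm (Fin n)) : Prop :=
  ∀ o o' p : Fin n, (p : ℕ) + 1 = n → ord o p = ord o' p → o = o'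

/-! Lower bound. Let `i` be the sender and `j` the receiver. By anonymity, what the players other
than `i` and `j` see has a law independent of the message `w`. Fix in addition the bits that `i` and
`j` exchange, which gives a view `u`. Executions with the same `u` can be cut and pasted: replacing
the coins and the input of `i` by those from another such execution changes nothing that the others
notice (`seenBy_run_update`). So, given `u`, the output of `j` does not depend on `w`, and the
probabilities of "`u` occurs and `w` is output correctly", summed over all `w`, are at most the
probability of the part of `u` seen by the others (`sum_prob_view_and_output_le`). A part `v` seen
by the others that shows fewer than `m` exchanged bits has at most `2 ^ (m - 1)` extensions `u`. If
`q` is the probability of such `v`, summing the success probabilities gives `2 ^ m * (1 - ε) ≤ 2 ^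
(m - 1) * q + 2 ^ m * (1 - q)`, that is, `q ≤ 2 * ε`. The number of exchanged bits is public, so
anonymity against the empty coalition carries the bound over to all roles
(`Anonymous.le_prob_exchanged`).

Codes. A message is read as a vector `a` over a field of characteristic two and sent with a random
point `x` and the value at `x` of `X ^ (d + 2) + ∑ a_i X ^ (i + 1)`. For odd `d`, a manipulation
survives only if `x` is a root of a nonzero polynomial of degree at most `d + 1`
(`card_eval_tagPolynomial_le`).

The protocol. In honest executions the receiver never decodes `⊥`, so each bit is an explicit
function of the coins (`value`, `transcript_eq`). Correctness follows by exchanging a double sum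
modulo two. For anonymity, an injective, weight-preserving map of the coins (`simulate`) turns an
execution with one choice of roles and message into one with another that looks the same to the
coalition. The communication is read off the fixed schedule, and Markov's inequality, summed over
all pairs of players, gives the comparison with other protocols. -/

/-- A transcript in which exactly the bits of the steps with property `p` can be read. -/
def Transcript.view {n : ℕ} (p : Step n → Prop) [DecidablePred p] (τ : Transcript n) : Seen n :=
  τ.map fun e => (e.1, if p e.1 then some e.2 else none)

/-- Hide all bits but those of the steps with property `q`. -/
def Seen.restrict {n : ℕ} (q : Step n → Prop) [DecidablePred q] (v : Seen n) : Seen n :=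
  v.map fun x => (x.1, if q x.1 then x.2 else none)

namespace Transcript

variable {n : ℕ}

theorem view_visibleTo (C : Finset (Fin n)) (τ : Transcript n) :
    τ.view (Step.VisibleTo C) = τ.seenBy C := rfl

theorem restrict_view {p q : Step n → Prop} [DecidablePred p] [DecidablePred q]
    (h : ∀ e, q e → p e) (τ : Transcript n) : (τ.view p).restrict q = τ.view q := by
  simp only [view, Seen.restrict, List.map_map]
  refine List.map_congr_left fun x _ => ?_
  by_cases hq : q x.1
  · simp [hq, h _ hq]
  · simp [hq]

theorem view_eq_of_view_eq {p q : Step n → Prop} [DecidablePred p] [DecidablePred q]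
    (h : ∀ e, q e → p e) {τ τ' : Transcript n} (hτ : τ.view p = τ'.view p) :
    τ.view q = τ'.view q := by
  rw [← restrict_view h, hτ, restrict_view h]

theorem view_append (p : Step n → Prop) [DecidablePred p] (τ τ' : Transcript n) :
    (τ ++ τ').view p = τ.view p ++ τ'.view p := by
  simp [view]

theorem view_singleton (p : Step n → Prop) [DecidablePred p] (e : Step n) (b : Bool) :
    view p [(e, b)] = [(e, if p e then some b else none)] := rfl

end Transcript

theorem Step.VisibleTo.mono {n : ℕ} {C D : Finset (Fin n)} (h : C ⊆ D) {e : Step n}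
    (he : e.VisibleTo C) : e.VisibleTo D := by
  rcases he with he | he | ⟨j, hj, he⟩
  · exact Or.inl he
  · exact Or.inr (Or.inl (h he))
  · exact Or.inr (Or.inr ⟨j, h hj, he⟩)

namespace Protocol

variable {n m : ℕ} (P : Protocol n m)

/-! ### Probabilities -/

/-- The probability of a family of coins. -/
noncomputable def weight (ω : P.Coins) : ℝ := ∏ i, (P.law i (ω i)).toReal

theorem weight_nonneg (ω : P.Coins) : 0 ≤ P.weight ω :=
  Finset.prod_nonneg fun _ _ => ENNReal.toReal_nonneg

theorem sum_weight : ∑ ω, P.weight ω = 1 := by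
  have h := Finset.prod_univ_sum (fun i => (Finset.univ : Finset (P.Coin i)))
    (fun i a => (P.law i a).toReal)
  rw [Fintype.piFinset_univ] at h
  unfold weight
  rw [← h]
  refine Finset.prod_eq_one fun i _ => ?_
  rw [← ENNReal.toReal_sum fun a _ => PMF.apply_ne_top _ _, ← tsum_fintype (L := .unconditional _),
    PMF.tsum_coe, ENNReal.toReal_one]

open Classical in
theorem prob_eq (E : P.Coins → Prop) :
    P.prob E = ∑ ω, P.weight ω * if E ω then 1 else 0 := rfl

theorem expect_mono {X Y : P.Coins → ℝ} (h : ∀ ω, X ω ≤ Y ω) : P.expect X ≤ P.expect Y :=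
  Finset.sum_le_sum fun ω _ => mul_le_mul_of_nonneg_left (h ω) (P.weight_nonneg ω)

theorem prob_nonneg (E : P.Coins → Prop) : 0 ≤ P.prob E := by
  classical
  rw [prob_eq]
  exact Finset.sum_nonneg fun ω _ => mul_nonneg (P.weight_nonneg ω) (by split_ifs <;> simp)

theorem prob_mono {E F : P.Coins → Prop} (h : ∀ ω, E ω → F ω) : P.prob E ≤ P.prob F := by
  classical
  refine P.expect_mono fun ω => ?_
  by_cases hE : E ω
  · simp [hE, h ω hE]
  · simp only [hE, if_false]; split_ifs <;> simp

theorem prob_congr {E F : P.Coins → Prop} (h : ∀ ω, E ω ↔ F ω) : P.prob E = P.prob F :=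
  congrArg P.prob (funext fun ω => propext (h ω))

theorem prob_of_forall {E : P.Coins → Prop} (h : ∀ ω, E ω) : P.prob E = 1 := by
  classical
  simpa [prob_eq, h] using P.sum_weight

theorem prob_add_prob_not (E : P.Coins → Prop) : P.prob E + P.prob (fun ω => ¬ E ω) = 1 := by
  classical
  rw [prob_eq, prob_eq, ← Finset.sum_add_distrib]
  refine Eq.trans ?_ P.sum_weight
  refine Finset.sum_congr rfl fun ω _ => ?_
  by_cases hE : E ω <;> simp [hE]

theorem prob_or_le (E F : P.Coins → Prop) :
    P.prob (fun ω => E ω ∨ F ω) ≤ P.prob E + P.prob F := by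
  classical
  rw [prob_eq, prob_eq, prob_eq, ← Finset.sum_add_distrib]
  refine Finset.sum_le_sum fun ω _ => ?_
  have := P.weight_nonneg ω
  by_cases hE : E ω <;> by_cases hF : F ω <;> simp [hE, hF, this]

theorem prob_eq_sum_fiber {α : Type*} (f : P.Coins → α) (s : Finset α) {E : P.Coins → Prop}
    (h : ∀ ω, E ω → f ω ∈ s) : P.prob E = ∑ a ∈ s, P.prob fun ω => f ω = a ∧ E ω := by
  classical
  simp only [prob_eq]
  rw [Finset.sum_comm]
  refine Finset.sum_congr rfl fun ω _ => ?_
  rw [← Finset.mul_sum]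
  congr 1
  by_cases hE : E ω
  · simp [hE, h ω hE]
  · simp [hE]

/-- Markov's inequality. -/
theorem mul_prob_le_expect (a : ℝ) (X : P.Coins → ℝ) (hX : ∀ ω, 0 ≤ X ω) :
    a * P.prob (fun ω => a ≤ X ω) ≤ P.expect X := by
  classical
  rw [prob_eq, Finset.mul_sum]
  refine Finset.sum_le_sum fun ω _ => ?_
  change _ ≤ P.weight ω * X ω
  have := P.weight_nonneg ω
  by_cases h : a ≤ X ω
  · simp only [h, if_true]; nlinarith
  · simp only [h, if_false]; have := mul_nonneg this (hX ω); linarith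

open Classical in
/-- Exchanging the coins of one player between two independent executions. -/
theorem prob_mul_prob_le (i : Fin n) {E F E' F' : P.Coins → Prop}
    (h : ∀ ω ω', E ω → F ω' →
      E' (Function.update ω' i (ω i)) ∧ F' (Function.update ω i (ω' i))) :
    P.prob E * P.prob F ≤ P.prob E' * P.prob F' := by
  let σ : P.Coins × P.Coins → P.Coins × P.Coins := fun x =>
    (Function.update x.2 i (x.1 i), Function.update x.1 i (x.2 i))
  have hσ : Function.Involutive σ := fun x => by simp [σ]
  have hw : ∀ x, P.weight (σ x).1 * P.weight (σ x).2 = P.weight x.1 * P.weight x.2 := by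
    intro x
    simp only [weight, ← Finset.prod_mul_distrib]
    refine Finset.prod_congr rfl fun l _ => ?_
    by_cases hl : l = i
    · subst hl; simp [σ]
    · simp [σ, hl, mul_comm]
  have hprod : ∀ A B : P.Coins → Prop, P.prob A * P.prob B =
      ∑ x : P.Coins × P.Coins, P.weight x.1 * P.weight x.2 * if A x.1 ∧ B x.2 then 1 else 0 := by
    intro A B
    rw [prob_eq, prob_eq, Finset.sum_mul_sum, Fintype.sum_prod_type]
    refine Finset.sum_congr rfl fun a _ => Finset.sum_congr rfl fun b _ => ?_
    by_cases hA : A a <;> by_cases hB : B b <;> simp [hA, hB]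
  rw [hprod, hprod, ← Equiv.sum_comp hσ.toPerm (fun x => P.weight x.1 * P.weight x.2 *
    if E' x.1 ∧ F' x.2 then 1 else 0)]
  refine Finset.sum_le_sum fun x _ => ?_
  simp only [Function.Involutive.coe_toPerm, hw]
  refine mul_le_mul_of_nonneg_left ?_ (mul_nonneg (P.weight_nonneg _) (P.weight_nonneg _))
  by_cases hx : E x.1 ∧ F x.2
  · have := h _ _ hx.1 hx.2
    simp [hx, σ, this]
  · rw [if_neg hx]
    exact ite_nonneg zero_le_one le_rfl

/-! ### Anonymity in terms of events -/

variable {P}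

open Classical in
-- The definition of anonymity fixes the coins of `C` through a family `c` for all players. Summing
-- over `c` counts each `ω` once for every choice of coins outside `C`, a positive factor that is
-- the same for all `ω` and cancels.
theorem Anonymous.prob_seenBy_eq (hP : P.Anonymous) {C : Finset (Fin n)} {S R S' R' : Fin n}
    {w w' : Bits m} (h : S ≠ R) (h' : S' ≠ R')
    (hC : ∀ i ∈ C, assign S R w i = assign S' R' w' i) (hR : R ∈ C → w = w') (v : Seen n) :
    (P.prob fun ω => (P.transcript (assign S R w) ω).seenBy C = v) =
      P.prob fun ω => (P.transcript (assign S' R' w') ω).seenBy C = v := by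
  have hN : ∀ ω : P.Coins, (∑ c : P.Coins, if ∀ i ∈ C, ω i = c i then (1 : ℝ) else 0) =
      ∏ i, if i ∈ C then (1 : ℝ) else Fintype.card (P.Coin i) := by
    intro ω
    rw [Finset.sum_boole]
    have : (Finset.univ.filter fun c : P.Coins => ∀ i ∈ C, ω i = c i) =
        Fintype.piFinset fun i => if i ∈ C then {ω i} else Finset.univ := by
      ext c
      simp only [Finset.mem_filter, Finset.mem_univ, true_and, Fintype.mem_piFinset]
      refine forall_congr' fun i => ?_
      by_cases hi : i ∈ C <;> simp [hi, eq_comm]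
    rw [this, Fintype.card_piFinset, Nat.cast_prod]
    refine Finset.prod_congr rfl fun i _ => ?_
    by_cases hi : i ∈ C <;> simp [hi]
  have hpos : (0 : ℝ) < ∏ i, if i ∈ C then (1 : ℝ) else Fintype.card (P.Coin i) := by
    refine Finset.prod_pos fun i _ => ?_
    obtain ⟨a, -⟩ := (P.law i).support_nonempty
    have : 0 < Fintype.card (P.Coin i) := Fintype.card_pos_iff.2 ⟨a⟩
    split_ifs
    · exact one_pos
    · exact_mod_cast this
  have key : ∀ E : P.Coins → Prop, (∑ c : P.Coins, P.prob fun ω => (∀ i ∈ C, ω i = c i) ∧ E ω) =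
      (∏ i, if i ∈ C then (1 : ℝ) else Fintype.card (P.Coin i)) * P.prob E := by
    intro E
    simp only [prob_eq]
    rw [Finset.sum_comm, Finset.mul_sum]
    refine Finset.sum_congr rfl fun ω _ => ?_
    rw [← Finset.mul_sum, ← hN ω]
    by_cases hE : E ω
    · simp [hE, mul_comm]
    · simp [hE]
  refine mul_left_cancel₀ hpos.ne' ?_
  rw [← key, ← key]
  exact Finset.sum_congr rfl fun c _ => hP C S R S' R' w w' h h' hC hR c v

theorem Anonymous.prob_congr_seenBy (hP : P.Anonymous) {C : Finset (Fin n)} {S R S' R' : Fin n}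
    {w w' : Bits m} (h : S ≠ R) (h' : S' ≠ R')
    (hC : ∀ i ∈ C, assign S R w i = assign S' R' w' i) (hR : R ∈ C → w = w')
    (A : Seen n → Prop) :
    (P.prob fun ω => A ((P.transcript (assign S R w) ω).seenBy C)) =
      P.prob fun ω => A ((P.transcript (assign S' R' w') ω).seenBy C) := by
  classical
  let f := fun ω => (P.transcript (assign S R w) ω).seenBy C
  let f' := fun ω => (P.transcript (assign S' R' w') ω).seenBy C
  have := P.prob_eq_sum_fiber f (Finset.univ.image f ∪ Finset.univ.image f')
    (E := fun ω => A (f ω)) (fun ω _ => by simp)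
  have h2 := P.prob_eq_sum_fiber f' (Finset.univ.image f ∪ Finset.univ.image f')
    (E := fun ω => A (f' ω)) (fun ω _ => by simp)
  refine this.trans (Eq.trans ?_ h2.symm)
  refine Finset.sum_congr rfl fun v _ => ?_
  by_cases hv : A v
  · rw [P.prob_congr (E := fun ω => f ω = v ∧ A (f ω)) (F := fun ω => f ω = v) fun ω =>
        ⟨fun h => h.1, fun h => ⟨h, by rw [h]; exact hv⟩⟩,
      P.prob_congr (E := fun ω => f' ω = v ∧ A (f' ω)) (F := fun ω => f' ω = v) fun ω =>
        ⟨fun h => h.1, fun h => ⟨h, by rw [h]; exact hv⟩⟩]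
    exact hP.prob_seenBy_eq h h' hC hR v
  · rw [P.prob_congr (E := fun ω => f ω = v ∧ A (f ω)) (F := fun ω => False) fun ω => ⟨fun h => hv (h.1 ▸ h.2), False.elim⟩,
      P.prob_congr (E := fun ω => f' ω = v ∧ A (f' ω)) (F := fun ω => False) fun ω =>
        ⟨fun h => hv (h.1 ▸ h.2), False.elim⟩]

/-! ### Cutting and pasting executions -/

variable (P)

theorem run_succ_of_none {inp : Fin n → Role m} {ω : P.Coins} {t : ℕ}
    (h : P.next ((P.run inp ω t).seenBy ∅) = none) : P.run inp ω (t + 1) = P.run inp ω t := by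
  simp only [run, h]

theorem run_succ_of_some {inp : Fin n → Role m} {ω : P.Coins} {t : ℕ} {e : Step n}
    (h : P.next ((P.run inp ω t).seenBy ∅) = some e) :
    P.run inp ω (t + 1) = P.run inp ω t ++
      [(e, P.bit e (inp e.src) (ω e.src) ((P.run inp ω t).seenBy {e.src}))] := by
  simp only [run, h]

/-- Until the protocol stops, each unit of time adds one entry. This makes earlier runs recoverable
as prefixes in `take_run_succ`. -/
theorem next_eq_none_or_length_run (inp : Fin n → Role m) (ω : P.Coins) (t : ℕ) :
    P.next ((P.run inp ω t).seenBy ∅) = none ∨ (P.run inp ω t).length = t := by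
  induction t with
  | zero => right; rfl
  | succ t ih =>
    cases h : P.next ((P.run inp ω t).seenBy ∅) with
    | none => left; rw [P.run_succ_of_none h, h]
    | some e =>
      right
      rw [P.run_succ_of_some h, List.length_append, ih.resolve_left (by simp [h])]
      rfl

theorem length_run_le (inp : Fin n → Role m) (ω : P.Coins) (t : ℕ) :
    (P.run inp ω t).length ≤ t := by
  induction t with
  | zero => exact le_rfl
  | succ t ih =>
    cases h : P.next ((P.run inp ω t).seenBy ∅) with
    | none => rw [P.run_succ_of_none h]; omega
    | some e => rw [P.run_succ_of_some h]; simpa using ih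

theorem take_run_succ (inp : Fin n → Role m) (ω : P.Coins) (t : ℕ) :
    (P.run inp ω (t + 1)).take t = P.run inp ω t := by
  cases h : P.next ((P.run inp ω t).seenBy ∅) with
  | none => rw [P.run_succ_of_none h, List.take_of_length_le (P.length_run_le inp ω t)]
  | some e =>
    have := (P.next_eq_none_or_length_run inp ω t).resolve_left (by simp [h])
    rw [P.run_succ_of_some h, List.take_append_of_le_length this.ge,
      List.take_of_length_le this.le]

/-- If two executions look the same but for the bits that `i` or `j` send to themselves, then `i`
can be moved from one to the other without anybody noticing. -/
theorem seenBy_run_update {i j : Fin n} (hij : i ≠ j) (inp inp' : Fin n → Role m)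
    (ω ω' : P.Coins) (t : ℕ)
    (h : (P.run inp ω t).view (fun e => e.VisibleTo {i}ᶜ ∧ e.VisibleTo {j}ᶜ) =
      (P.run inp' ω' t).view (fun e => e.VisibleTo {i}ᶜ ∧ e.VisibleTo {j}ᶜ)) :
    (P.run (Function.update inp i (inp' i)) (Function.update ω i (ω' i)) t).seenBy {i}ᶜ =
        (P.run inp ω t).seenBy {i}ᶜ ∧
      (P.run (Function.update inp i (inp' i)) (Function.update ω i (ω' i)) t).seenBy {i} =
        (P.run inp' ω' t).seenBy {i} := by
  induction t with
  | zero => exact ⟨rfl, rfl⟩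
  | succ t ih =>
    have ht : (P.run inp ω t).view (fun e => e.VisibleTo {i}ᶜ ∧ e.VisibleTo {j}ᶜ) =
        (P.run inp' ω' t).view (fun e => e.VisibleTo {i}ᶜ ∧ e.VisibleTo {j}ᶜ) := by
      rw [← P.take_run_succ inp, ← P.take_run_succ inp']
      have := congrArg (List.take t) h
      simpa only [Transcript.view, List.map_take] using this
    obtain ⟨ih1, ih2⟩ := ih ht
    -- Public information agrees in all three executions, so they take the same next step.
    have hpub : (P.run inp ω t).seenBy ∅ = (P.run inp' ω' t).seenBy ∅ :=
      Transcript.view_eq_of_view_eq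
        (fun e he => ⟨he.mono (Finset.empty_subset _), he.mono (Finset.empty_subset _)⟩) ht
    have hpub' : (P.run (Function.update inp i (inp' i)) (Function.update ω i (ω' i)) t).seenBy ∅ =
        (P.run inp ω t).seenBy ∅ :=
      Transcript.view_eq_of_view_eq (p := Step.VisibleTo {i}ᶜ)
        (fun e he => he.mono (Finset.empty_subset _)) ih1
    cases hn : P.next ((P.run inp ω t).seenBy ∅) with
    | none =>
      have hn' := hpub ▸ hn
      have hn'' := hpub'.symm ▸ hn
      rw [P.run_succ_of_none hn, P.run_succ_of_none hn', P.run_succ_of_none hn'']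
      exact ⟨ih1, ih2⟩
    | some e =>
      have hn' := hpub ▸ hn
      have hn'' := hpub'.symm ▸ hn
      rw [P.run_succ_of_some hn, P.run_succ_of_some hn'] at h
      rw [P.run_succ_of_some hn, P.run_succ_of_some hn', P.run_succ_of_some hn'']
      simp only [← Transcript.view_visibleTo, Transcript.view_append] at h ih1 ih2 ⊢
      rw [ih1, ih2]
      rw [ht] at h
      have h := List.append_cancel_left h
      simp only [Transcript.view_singleton] at h ⊢
      -- If `i` speaks, the bit is that of the second execution, and by `h` it agrees with the first
      -- wherever the others read it. If somebody else speaks, the two executions change places.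
      by_cases hi : e.src = i
      · subst hi
        simp only [Function.update_self]
        rw [ih2]
        refine ⟨?_, rfl⟩
        congr 1
        by_cases he : e.VisibleTo {e.src}ᶜ
        · have he' : e.VisibleTo {j}ᶜ := Or.inr (Or.inl (by simpa using hij))
          simpa [he, he'] using h.symm
        · simp [he]
      · have hs := Transcript.view_eq_of_view_eq (p := Step.VisibleTo {i}ᶜ)
          (q := Step.VisibleTo {e.src})
          (fun e' he' => he'.mono (by simpa using fun h => hi h.symm)) ih1
        simp only [Function.update_of_ne hi]
        rw [hs]
        refine ⟨rfl, ?_⟩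
        congr 1
        by_cases he : e.VisibleTo {i}
        · have h1 : e.VisibleTo {i}ᶜ := Or.inr (Or.inl (by simpa using hi))
          have h2 : e.VisibleTo {j}ᶜ := he.mono (by simpa using hij.symm)
          simpa [he, h1, h2] using h
        · simp [he]

end Protocol

/-! ### Counting the possible contents of one private channel -/

/-- Number of private bits that `i` and `j` exchange. -/
def Seen.exchanged {n : ℕ} (i j : Fin n) (v : Seen n) : ℕ :=
  (v.countP fun x => decide (x.1.src = i ∧ x.1.dst = some j)) +
    v.countP fun x => decide (x.1.src = j ∧ x.1.dst = some i)

theorem Transcript.exchanged_seenBy {n : ℕ} (i j : Fin n) (C : Finset (Fin n))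
    (τ : Transcript n) :
    (τ.seenBy C).exchanged i j = τ.privateBits i j + τ.privateBits j i := by
  simp only [Seen.exchanged, Transcript.seenBy, List.countP_map]
  rfl

open Classical in
/-- The ways to fill in the bits that `i` and `j` exchange. -/
noncomputable def Seen.fill {n : ℕ} (i j : Fin n) : Seen n → Finset (Seen n)
  | [] => {[]}
  | x :: v =>
    if (x.1.src = i ∧ x.1.dst = some j) ∨ (x.1.src = j ∧ x.1.dst = some i) then
      (Seen.fill i j v).image (List.cons (x.1, some true)) ∪
        (Seen.fill i j v).image (List.cons (x.1, some false))
    else (Seen.fill i j v).image (List.cons x)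

theorem Seen.card_fill_le {n : ℕ} {i j : Fin n} (hij : i ≠ j) (v : Seen n) :
    (v.fill i j).card ≤ 2 ^ v.exchanged i j := by
  classical
  induction v with
  | nil => simp [Seen.fill, Seen.exchanged]
  | cons x v ih =>
    by_cases h1 : x.1.src = i ∧ x.1.dst = some j
    · have he : exchanged i j (x :: v) = exchanged i j v + 1 := by
        simp [exchanged, h1, hij]; omega
      rw [he, pow_succ, fill, if_pos (Or.inl h1)]
      refine (Finset.card_union_le _ _).trans ?_
      have := Finset.card_image_le (s := fill i j v) (f := List.cons (x.1, some true))
      have := Finset.card_image_le (s := fill i j v) (f := List.cons (x.1, some false))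
      omega
    · by_cases h2 : x.1.src = j ∧ x.1.dst = some i
      · have he : exchanged i j (x :: v) = exchanged i j v + 1 := by
          simp [exchanged, h2, hij.symm]; omega
        rw [he, pow_succ, fill, if_pos (Or.inr h2)]
        refine (Finset.card_union_le _ _).trans ?_
        have := Finset.card_image_le (s := fill i j v) (f := List.cons (x.1, some true))
        have := Finset.card_image_le (s := fill i j v) (f := List.cons (x.1, some false))
        omega
      · have he : exchanged i j (x :: v) = exchanged i j v := by
          simp only [exchanged, List.countP_cons, h1, h2]; simp
        rw [he, fill, if_neg (by tauto)]
        exact Finset.card_image_le.trans ih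

/-- A bit escapes `{i}ᶜ` only if `i` sends it to himself, which the model permits. Apart from such
bits and those between `i` and `j`, everything is read by somebody outside the pair. -/
theorem Step.visibleTo_compl_pair {n : ℕ} {i j : Fin n} (hij : i ≠ j) (e : Step n)
    (h : e.VisibleTo {i}ᶜ ∧ e.VisibleTo {j}ᶜ)
    (h' : ¬ ((e.src = i ∧ e.dst = some j) ∨ (e.src = j ∧ e.dst = some i))) :
    e.VisibleTo {i, j}ᶜ := by
  obtain ⟨src, dst, tag⟩ := e
  simp only [Step.VisibleTo, Finset.mem_compl, Finset.mem_singleton, Finset.mem_insert] at h h' ⊢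
  cases dst with
  | none => simp
  | some d =>
    simp only [Option.some.injEq, reduceCtorEq, false_or] at h h' ⊢
    obtain ⟨h1, h2⟩ := h
    by_cases hs : src = i
    · subst hs
      obtain h1 | ⟨a, ha, rfl⟩ := h1
      · exact absurd rfl h1
      · exact Or.inr ⟨_, by tauto, rfl⟩
    · by_cases hs' : src = j
      · subst hs'
        obtain h2 | ⟨a, ha, rfl⟩ := h2
        · exact absurd rfl h2
        · exact Or.inr ⟨_, by tauto, rfl⟩
      · exact Or.inl (by tauto)

theorem Transcript.view_mem_fill {n : ℕ} {i j : Fin n} (hij : i ≠ j) (τ : Transcript n) :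
    τ.view (fun e => e.VisibleTo {i}ᶜ ∧ e.VisibleTo {j}ᶜ) ∈ (τ.seenBy {i, j}ᶜ).fill i j := by
  classical
  induction τ with
  | nil => simp [view, seenBy, Seen.fill]
  | cons x τ ih =>
    simp only [view, seenBy, List.map_cons, Seen.fill] at ih ⊢
    by_cases h1 : (x.1.src = i ∧ x.1.dst = some j) ∨ (x.1.src = j ∧ x.1.dst = some i)
    · have h2 : x.1.VisibleTo {i}ᶜ ∧ x.1.VisibleTo {j}ᶜ := by
        rcases h1 with h1 | h1
        · exact ⟨Or.inr (Or.inr ⟨j, by simpa using hij.symm, h1.2⟩),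
            Or.inr (Or.inl (by simpa [h1.1] using hij))⟩
        · exact ⟨Or.inr (Or.inl (by simpa [h1.1] using hij.symm)),
            Or.inr (Or.inr ⟨i, by simpa using hij, h1.2⟩)⟩
      rw [if_pos h1, if_pos h2]
      cases x.2
      · exact Finset.mem_union_right _ (Finset.mem_image_of_mem _ ih)
      · exact Finset.mem_union_left _ (Finset.mem_image_of_mem _ ih)
    · rw [if_neg h1]
      have h2 : x.1.VisibleTo {i, j}ᶜ ↔ x.1.VisibleTo {i}ᶜ ∧ x.1.VisibleTo {j}ᶜ :=
        ⟨fun h => ⟨h.mono (by simp), h.mono (by simp)⟩,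
          fun h => Step.visibleTo_compl_pair hij _ h h1⟩
      simp only [h2]
      exact Finset.mem_image_of_mem _ ih

/-- Only the sender's input contains the message, so pasting in the sender of another execution
changes the message and nothing else. -/
theorem update_assign {n m : ℕ} {i j : Fin n} (w w' : Bits m) :
    Function.update (assign i j w) i (assign i j w' i) = assign i j w' := by
  funext l
  by_cases h : l = i
  · subst h; simp
  · simp [h, assign]

/-! ### The lower bound for each private channel -/

namespace Protocol

variable {n m : ℕ} {P : Protocol n m}

/-- The messages cannot all be likely to be received with the same bits on the channel. -/
theorem sum_prob_view_and_output_le {i j : Fin n} (hij : i ≠ j) (U : Seen n) (q : ℝ)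
    (hq : 0 ≤ q)
    (h : ∀ w, (P.prob fun ω => (P.transcript (assign i j w) ω).view
      (fun e => e.VisibleTo {i}ᶜ ∧ e.VisibleTo {j}ᶜ) = U) ≤ q) :
    (∑ w, P.prob fun ω => (P.transcript (assign i j w) ω).view
      (fun e => e.VisibleTo {i}ᶜ ∧ e.VisibleTo {j}ᶜ) = U ∧
        P.output (assign i j w) ω j = some w) ≤ q := by
  classical
  let A : Bits m → P.Coins → Prop := fun w ω => (P.transcript (assign i j w) ω).view
      (fun e => e.VisibleTo {i}ᶜ ∧ e.VisibleTo {j}ᶜ) = U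
  let B : Bits m → P.Coins → Bits m → Prop := fun w ω u => P.output (assign i j w) ω j = some u
  change (∑ w, P.prob fun ω => A w ω ∧ B w ω w) ≤ q
  have mix : ∀ w w' ω ω', A w ω → A w' ω' → A w' (Function.update ω i (ω' i)) ∧
      ∀ u, B w ω u → B w' (Function.update ω i (ω' i)) u := by
    intro w w' ω ω' hA hA'
    obtain ⟨h1, -⟩ := P.seenBy_run_update hij (assign i j w) (assign i j w') ω ω' P.steps
      (hA.trans hA'.symm)
    rw [update_assign] at h1
    refine ⟨?_, fun u hu => ?_⟩
    · refine Eq.trans ?_ hA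
      exact Transcript.view_eq_of_view_eq (p := Step.VisibleTo {i}ᶜ) (fun e he => he.1) h1
    · have h2 := Transcript.view_eq_of_view_eq (p := Step.VisibleTo {i}ᶜ)
        (q := Step.VisibleTo {j}) (fun e he => he.mono (by simpa using hij)) h1
      refine Eq.trans ?_ hu
      simp only [output, transcript, ← Transcript.view_visibleTo, h2,
        Function.update_of_ne hij.symm]
  -- All messages are compared with one for which `U` is most likely. Multiplying by `P.prob (A w₀)`
  -- takes the place of conditioning on `U`.
  obtain ⟨w₀, -, hw₀⟩ := Finset.exists_max_image Finset.univ (fun w => P.prob (A w))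
    ⟨fun _ => false, Finset.mem_univ _⟩
  by_cases h0 : P.prob (A w₀) = 0
  · refine le_trans (Finset.sum_nonpos fun w _ => ?_) hq
    refine (P.prob_mono fun ω hω => hω.1).trans ((hw₀ w (Finset.mem_univ _)).trans h0.le)
  refine le_trans ?_ (h w₀)
  have hpos : 0 < P.prob (A w₀) := lt_of_le_of_ne (P.prob_nonneg _) (Ne.symm h0)
  refine le_of_mul_le_mul_right ?_ hpos
  rw [Finset.sum_mul]
  calc (∑ w, P.prob (fun ω => A w ω ∧ B w ω w) * P.prob (A w₀))
      ≤ ∑ w, P.prob (A w₀) * P.prob (fun ω => A w₀ ω ∧ B w₀ ω w) := by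
        refine Finset.sum_le_sum fun w _ => ?_
        -- Exchanging the senders of the two executions leaves the receiver, with his output `w`, in
        -- an execution whose message is `w₀`.
        refine (P.prob_mul_prob_le i (E' := A w) (F' := fun ω => A w₀ ω ∧ B w₀ ω w) ?_).trans
          (mul_le_mul_of_nonneg_right (hw₀ w (Finset.mem_univ _)) (P.prob_nonneg _))
        intro ω ω' h1 h2
        exact ⟨(mix w₀ w ω' ω h2 h1.1).1, (mix w w₀ ω ω' h1.1 h2).1,
          (mix w w₀ ω ω' h1.1 h2).2 w h1.2⟩
    _ = P.prob (A w₀) * ∑ w, P.prob (fun ω => A w₀ ω ∧ B w₀ ω w) := by rw [Finset.mul_sum]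
    _ ≤ P.prob (A w₀) * P.prob (A w₀) := by
        refine mul_le_mul_of_nonneg_left ?_ hpos.le
        simp only [prob_eq]
        rw [Finset.sum_comm]
        refine Finset.sum_le_sum fun ω _ => ?_
        rw [← Finset.mul_sum]
        refine mul_le_mul_of_nonneg_left ?_ (P.weight_nonneg ω)
        -- An execution has at most one output, so at most one term of the sum over `w` is nonzero.
        by_cases hA : A w₀ ω
        · cases ho : P.output (assign i j w₀) ω j with
          | none => simp [hA, B, ho]
          | some u => simp [hA, B, ho]
        · simp [hA]

theorem Anonymous.le_prob_exchanged_aux (hP : P.Anonymous) {ε : ℝ} (hc : P.CorrectUpTo ε)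
    {i j : Fin n} (hij : i ≠ j) (w₀ : Bits m) :
    (P.prob fun ω => ¬ m ≤ ((P.transcript (assign i j w₀) ω).seenBy {i, j}ᶜ).exchanged i j) ≤
      2 * ε := by
  classical
  let V : Bits m → P.Coins → Seen n := fun w ω => (P.transcript (assign i j w) ω).seenBy {i, j}ᶜ
  let U : Bits m → P.Coins → Seen n := fun w ω => (P.transcript (assign i j w) ω).view
      (fun e => e.VisibleTo {i}ᶜ ∧ e.VisibleTo {j}ᶜ)
  have hsub : ∀ e : Step n, e.VisibleTo {i, j}ᶜ → e.VisibleTo {i}ᶜ ∧ e.VisibleTo {j}ᶜ :=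
    fun e he => ⟨he.mono (by simp), he.mono (by simp)⟩
  -- `U` also contains what `i` and `j` exchange; `V` is the part of it that the other players see,
  -- and only the law of `V` is controlled by anonymity.
  have hUV : ∀ w ω, (U w ω).restrict (Step.VisibleTo {i, j}ᶜ) = V w ω := fun w ω =>
    Transcript.restrict_view hsub _
  have hanon : ∀ (w : Bits m) (A : Seen n → Prop),
      (P.prob fun ω => A (V w ω)) = P.prob fun ω => A (V w₀ ω) := by
    intro w A
    refine hP.prob_congr_seenBy hij hij (fun l hl => ?_) (fun h => ?_) A
    · simp only [Finset.mem_compl, Finset.mem_insert, Finset.mem_singleton, not_or] at hl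
      simp [assign, hl.1, hl.2]
    · simp at h
  let q := P.prob fun ω => ¬ m ≤ (V w₀ ω).exchanged i j
  change q ≤ 2 * ε
  let 𝒱 : Finset (Seen n) := (Finset.univ.image (V w₀)).filter
    fun v => ¬ m ≤ v.exchanged i j
  let 𝒰 : Finset (Seen n) := (Finset.univ.biUnion fun w => Finset.univ.image (U w)).filter
    fun u => ¬ m ≤ (u.restrict (Step.VisibleTo {i, j}ᶜ)).exchanged i j
  have hsingle : ∀ u : Seen n, (∑ w, P.prob fun ω => U w ω = u ∧
      P.output (assign i j w) ω j = some w) ≤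
        P.prob fun ω => V w₀ ω = u.restrict (Step.VisibleTo {i, j}ᶜ) := by
    intro u
    refine sum_prob_view_and_output_le hij u _ (P.prob_nonneg _) fun w => ?_
    rw [← hanon w fun v => v = u.restrict (Step.VisibleTo {i, j}ᶜ)]
    exact P.prob_mono fun ω hω => by rw [← hUV, ← hω]
  have hle : ∀ w, (P.prob fun ω => P.output (assign i j w) ω j = some w) ≤
      (∑ u ∈ 𝒰, P.prob fun ω => U w ω = u ∧ P.output (assign i j w) ω j = some w) + (1 - q) := by
    intro w
    have h1 : (P.prob fun ω => m ≤ (V w ω).exchanged i j) = 1 - q := by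
      rw [hanon w (fun v => m ≤ v.exchanged i j), eq_sub_iff_add_eq]
      exact P.prob_add_prob_not _
    have h2 := P.prob_eq_sum_fiber (U w) 𝒰
      (E := fun ω => ¬ m ≤ (V w ω).exchanged i j ∧ P.output (assign i j w) ω j = some w)
      (fun ω hω => by
        simp only [𝒰, Finset.mem_filter, Finset.mem_biUnion, Finset.mem_univ, true_and,
          Finset.mem_image, hUV]
        exact ⟨⟨w, ω, rfl⟩, hω.1⟩)
    rw [← h1]
    refine (P.prob_mono (F := fun ω => (¬ m ≤ (V w ω).exchanged i j ∧
      P.output (assign i j w) ω j = some w) ∨ m ≤ (V w ω).exchanged i j) fun ω hω => by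
        tauto).trans ((P.prob_or_le _ _).trans ?_)
    rw [h2]
    refine add_le_add_left (Finset.sum_le_sum fun u _ => ?_) _
    exact P.prob_mono fun ω hω => ⟨hω.1, hω.2.2⟩
  have hcount : (∑ u ∈ 𝒰, P.prob fun ω => V w₀ ω = u.restrict (Step.VisibleTo {i, j}ᶜ)) ≤
      2 ^ m / 2 * q := by
    have hzero : ∀ v, (P.prob fun ω => V w₀ ω = v) ≠ 0 → ∃ ω, V w₀ ω = v := by
      intro v hv
      by_contra hne
      push Not at hne
      exact hv (by simp [prob_eq, hne])
    have hq : q = ∑ v ∈ 𝒱, P.prob fun ω => V w₀ ω = v := by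
      refine (P.prob_eq_sum_fiber (V w₀) 𝒱 (fun ω hω => ?_)).trans
        (Finset.sum_congr rfl fun v hv => P.prob_congr fun ω => ⟨fun h => h.1, fun h => ⟨h, ?_⟩⟩)
      · exact Finset.mem_filter.2 ⟨Finset.mem_image_of_mem _ (Finset.mem_univ _), hω⟩
      · rw [h]; exact (Finset.mem_filter.1 hv).2
    rw [hq, Finset.mul_sum]
    -- Views `u` whose restriction never occurs with message `w₀` contribute nothing. The others are
    -- grouped by their restriction `v`, and each group consists of fillings of `v`.
    have hfilter : (∑ u ∈ 𝒰, P.prob fun ω => V w₀ ω = u.restrict (Step.VisibleTo {i, j}ᶜ)) =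
        ∑ u ∈ 𝒰.filter (fun u => u.restrict (Step.VisibleTo {i, j}ᶜ) ∈ 𝒱),
          P.prob fun ω => V w₀ ω = u.restrict (Step.VisibleTo {i, j}ᶜ) := by
      refine (Finset.sum_filter_of_ne fun u hu hne => ?_).symm
      obtain ⟨ω, hω⟩ := hzero _ hne
      refine Finset.mem_filter.2 ⟨?_, (Finset.mem_filter.1 hu).2⟩
      rw [← hω]
      exact Finset.mem_image_of_mem _ (Finset.mem_univ _)
    rw [hfilter, ← Finset.sum_fiberwise_of_maps_to (t := 𝒱)
      (g := Seen.restrict (Step.VisibleTo {i, j}ᶜ)) fun u hu => (Finset.mem_filter.1 hu).2]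
    refine Finset.sum_le_sum fun v hv => ?_
    rw [Finset.sum_congr rfl (g := fun _ => P.prob fun ω => V w₀ ω = v)
      fun u hu => by rw [(Finset.mem_filter.1 hu).2], Finset.sum_const, nsmul_eq_mul]
    refine mul_le_mul_of_nonneg_right ?_ (P.prob_nonneg _)
    rw [le_div_iff₀ two_pos]
    have hcard : (((𝒰.filter fun u => u.restrict (Step.VisibleTo {i, j}ᶜ) ∈ 𝒱).filter
        fun u => u.restrict (Step.VisibleTo {i, j}ᶜ) = v)).card ≤ 2 ^ v.exchanged i j := by
      refine (Finset.card_le_card fun u hu => ?_).trans (Seen.card_fill_le hij v)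
      simp only [𝒰, Finset.mem_filter, Finset.mem_biUnion, Finset.mem_univ, true_and,
        Finset.mem_image] at hu
      obtain ⟨⟨⟨⟨w, ω, rfl⟩, -⟩, -⟩, rfl⟩ := hu
      rw [hUV]
      exact Transcript.view_mem_fill hij _
    -- Fewer than `m` exchanged bits leave at most half of `2 ^ m` fillings, which is the factor `2
    -- ^ m / 2`.
    have hlt : v.exchanged i j + 1 ≤ m := by
      have := (Finset.mem_filter.1 hv).2; omega
    exact_mod_cast (Nat.mul_le_mul_right 2 hcard).trans
      ((pow_succ 2 _).symm.le.trans (Nat.pow_le_pow_right two_pos hlt))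
  have htotal : (2 : ℝ) ^ m * (1 - ε) ≤ 2 ^ m / 2 * q + 2 ^ m * (1 - q) := by
    have hcard : (Finset.univ : Finset (Bits m)).card = 2 ^ m := by simp
    calc (2 : ℝ) ^ m * (1 - ε) = ∑ _w : Bits m, (1 - ε) := by
          rw [Finset.sum_const, hcard, nsmul_eq_mul]; push_cast; rfl
      _ ≤ ∑ w, ((∑ u ∈ 𝒰, P.prob fun ω => U w ω = u ∧
            P.output (assign i j w) ω j = some w) + (1 - q)) :=
          Finset.sum_le_sum fun w _ => (hc i j w hij).trans (hle w)
      _ = (∑ u ∈ 𝒰, ∑ w, P.prob fun ω => U w ω = u ∧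
            P.output (assign i j w) ω j = some w) + 2 ^ m * (1 - q) := by
          rw [Finset.sum_add_distrib, Finset.sum_comm, Finset.sum_const, hcard, nsmul_eq_mul]
          push_cast; rfl
      _ ≤ _ := add_le_add_left ((Finset.sum_le_sum fun u _ => hsingle u).trans hcount) _
  have hpos : (0 : ℝ) < 2 ^ m := by positivity
  nlinarith

/-- The steps are visible even to the empty coalition, so the number of exchanged bits has the same
law as when `i` is the sender and `j` the receiver. -/
theorem Anonymous.le_prob_exchanged (hP : P.Anonymous) {ε : ℝ} (hc : P.CorrectUpTo ε)
    {S R : Fin n} (w : Bits m) (hSR : S ≠ R) {i j : Fin n} (hij : i ≠ j) :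
    1 - 2 * ε ≤ P.prob fun ω => m ≤ (P.transcript (assign S R w) ω).privateBits i j +
      (P.transcript (assign S R w) ω).privateBits j i := by
  have h1 := hP.le_prob_exchanged_aux hc hij w
  have h2 := hP.prob_congr_seenBy (C := ∅) (w := w) (w' := w) hSR hij (by simp) (by simp)
    (fun v => m ≤ v.exchanged i j)
  have h3 := P.prob_add_prob_not
    fun ω => m ≤ ((P.transcript (assign i j w) ω).seenBy {i, j}ᶜ).exchanged i j
  simp only [Transcript.exchanged_seenBy] at h1 h2 h3
  linarith

end Protocol

/-! ### Algebraic manipulation detection codes from polynomials in characteristic two -/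

section Tag

open Polynomial

variable {K : Type*} [Field K]

/-- The part of `tagPolynomial` that is linear in `a`. -/
noncomputable def lowTag {d : ℕ} (a : Fin d → K) : K[X] := ∑ i, C (a i) * X ^ (i.val + 1)

/-- The polynomial whose value at a random place authenticates the vector `a`. -/
noncomputable def tagPolynomial {d : ℕ} (a : Fin d → K) : K[X] := X ^ (d + 2) + lowTag a

theorem natDegree_lowTag_le {d : ℕ} (a : Fin d → K) : (lowTag a).natDegree ≤ d :=
  natDegree_sum_le_of_forall_le _ _ fun i _ => (natDegree_C_mul_X_pow_le _ _).trans i.isLt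

theorem coeff_lowTag {d : ℕ} (a : Fin d → K) (i : Fin d) :
    (lowTag a).coeff (i.val + 1) = a i := by
  classical
  simp only [lowTag, finsetSum_coeff, coeff_C_mul, coeff_X_pow]
  rw [Finset.sum_eq_single i]
  · simp
  · intro j _ hj
    have : ¬ i.val = j.val := fun h => hj (Fin.ext h.symm)
    simp [this]
  · simp

variable [Fintype K] [CharP K 2]

open Classical in
-- The points counted are roots of `p + g`, in which the leading terms cancel. The coefficient of `X
-- ^ (d + 1)` is `(d + 2) * δ`, which equals `δ` because `d` is odd. If `δ = 0`, the remaining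
-- coefficients are those of `a' - a` and, since `lowTag` has no constant term, `-t`.
theorem card_eval_tagPolynomial_le {d : ℕ} (hd : Odd d) (a a' : Fin d → K) (δ t : K)
    (h : ¬ (a' = a ∧ δ = 0 ∧ t = 0)) :
    (Finset.univ.filter fun x =>
      (tagPolynomial a').eval (x + δ) = (tagPolynomial a).eval x + t).card ≤ d + 1 := by
  let p : K[X] := (X + C δ) ^ (d + 2) - X ^ (d + 2)
  let g : K[X] := (lowTag a').comp (X + C δ) - lowTag a - C t
  have hg : g.natDegree ≤ d := by
    refine (natDegree_sub_C).le.trans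
      ((natDegree_sub_le_of_le ?_ (natDegree_lowTag_le a)).trans (max_self d).le)
    refine natDegree_comp_le.trans ?_
    rw [natDegree_X_add_C, mul_one]
    exact natDegree_lowTag_le a'
  have hp : p.natDegree ≤ d + 1 := by
    rw [natDegree_le_iff_coeff_eq_zero]
    intro N hN
    simp only [p, coeff_sub, coeff_X_add_C_pow, coeff_X_pow]
    rcases (show d + 2 ≤ N from hN).eq_or_lt with rfl | hN
    · simp
    · simp [Nat.choose_eq_zero_of_lt hN, hN.ne']
  have hdeg : (p + g).natDegree ≤ d + 1 :=
    (natDegree_add_le_of_degree_le hp (hg.trans (Nat.le_succ d)))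
  have hne : p + g ≠ 0 := by
    intro h0
    have hδ : δ = 0 := by
      have h1 := congrArg (fun q => coeff q (d + 1)) h0
      simp only [coeff_add, coeff_zero, coeff_eq_zero_of_natDegree_lt (Nat.lt_succ_of_le hg),
        add_zero] at h1
      have h2 : ((d + 2 : ℕ) : K) = 1 := by
        obtain ⟨c, rfl⟩ := hd
        have : ((2 : ℕ) : K) = 0 := CharP.cast_eq_zero K 2
        rw [show 2 * c + 1 + 2 = 2 * (c + 1) + 1 by ring, Nat.cast_add, Nat.cast_mul, this]
        simp
      simp only [p, coeff_sub, coeff_X_add_C_pow, coeff_X_pow] at h1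
      rw [Nat.choose_succ_self_right (d + 1), h2] at h1
      simpa using h1
    have hp0 : p = 0 := by simp [p, hδ]
    rw [hp0, zero_add] at h0
    have ha : a' = a := by
      funext i
      have h1 := congrArg (fun q => coeff q (i.val + 1)) h0
      simpa [g, hδ, coeff_lowTag, sub_eq_zero, coeff_C] using h1
    refine h ⟨ha, hδ, ?_⟩
    simpa [g, hδ, ha] using h0
  refine (Finset.card_le_card (t := (p + g).roots.toFinset) fun x hx => ?_).trans
    ((Multiset.toFinset_card_le _).trans ((card_roots' _).trans hdeg))
  rw [Multiset.mem_toFinset, mem_roots hne, IsRoot.def]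
  have := (Finset.mem_filter.1 hx).2
  simp only [tagPolynomial, eval_add, eval_pow, eval_X] at this
  simp only [p, g, eval_add, eval_sub, eval_pow, eval_X, eval_C, eval_comp]
  linear_combination this

end Tag

/-- Bit strings as vectors. -/
def Bits.toVector {N : ℕ} (a : Bits N) : Fin N → ZMod 2 := fun k => if a k then 1 else 0

/-- Vectors as bit strings. -/
def Bits.ofVector {N : ℕ} (z : Fin N → ZMod 2) : Bits N := fun k => decide (z k = 1)

theorem Bits.ofVector_toVector {N : ℕ} (a : Bits N) : Bits.ofVector a.toVector = a := by
  funext k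
  cases h : a k <;> simp [toVector, ofVector, h]

theorem Bits.toVector_ofVector {N : ℕ} (z : Fin N → ZMod 2) : (Bits.ofVector z).toVector = z := by
  funext k
  have : ∀ x : ZMod 2, (if decide (x = 1) = true then (1 : ZMod 2) else 0) = x := by decide
  exact this (z k)

theorem Bits.toVector_add {N : ℕ} (a b : Bits N) :
    (a.add b).toVector = a.toVector + b.toVector := by
  funext k
  have h2 : (1 + 1 : ZMod 2) = 0 := by decide
  cases ha : a k <;> cases hb : b k <;> simp [toVector, add, ha, hb, h2]

theorem AMDCode.nonempty_of_odd {m s d : ℕ} (hk : Nat.clog 2 m + s ≠ 0) (hd : Odd d)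
    (hm : m ≤ d * (Nat.clog 2 m + s)) (hds : s = 0 ∨ d + 1 ≤ 2 ^ Nat.clog 2 m) :
    Nonempty (AMDCode m s) := by
  classical
  let K := GaloisField 2 (Nat.clog 2 m + s)
  let _ : Fintype K := Fintype.ofFinite K
  have hrank : Module.finrank (ZMod 2) K = Nat.clog 2 m + s := GaloisField.finrank 2 hk
  have hcard : Fintype.card K = 2 ^ (Nat.clog 2 m + s) := by
    rw [← Nat.card_eq_fintype_card, GaloisField.card 2 _ hk]
  obtain ⟨ι, hι⟩ : ∃ f : (Fin m → ZMod 2) →ₗ[ZMod 2] (Fin d → K), Function.Injective f := by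
    rw [← finrank_le_iff_exists_linearMap, Module.finrank_fin_fun, Module.finrank_pi_fintype]
    simpa [hrank] using hm
  -- The length of the code words is exactly the dimension of message, point and tag. Linearity
  -- turns bit flips into independent shifts of the three parts.
  let E : (Fin (amdLength m s) → ZMod 2) ≃ₗ[ZMod 2] (Fin m → ZMod 2) × K × K :=
    LinearEquiv.ofFinrankEq _ _ (by
      rw [Module.finrank_prod, Module.finrank_prod, hrank, Module.finrank_fin_fun,
        Module.finrank_fin_fun, amdLength]
      ring)
  let tag : (Fin m → ZMod 2) → K → K := fun z x => (tagPolynomial (ι z)).eval x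
  let enc : Bits m → K → Bits (amdLength m s) := fun w x =>
    Bits.ofVector (E.symm (w.toVector, x, tag w.toVector x))
  let dec : Bits (amdLength m s) → Option (Bits m) := fun b =>
    if tag (E b.toVector).1 (E b.toVector).2.1 = (E b.toVector).2.2 then
      some (Bits.ofVector (E b.toVector).1) else none
  refine ⟨{ Coin := K, enc := enc, dec := dec, dec_enc := ?_, detect := ?_ }⟩
  · intro w c
    simp [dec, enc, Bits.toVector_ofVector, Bits.ofVector_toVector]
  · intro w δ hδ
    have hKpos : (0 : ℝ) < Fintype.card K := by rw [hcard]; positivity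
    rw [div_le_iff₀ hKpos]
    -- For `s = 0` the required bound is `1`. Otherwise there are at most `d + 1 ≤ 2 ^ Nat.clog 2 m`
    -- bad points among `2 ^ (Nat.clog 2 m + s)`.
    rcases hds with rfl | hds
    · rw [pow_zero, one_mul]
      exact_mod_cast Finset.card_le_univ _
    have hle : (Finset.univ.filter fun c => dec ((enc w c).add δ) ≠ none).card ≤ d + 1 := by
      refine le_trans (Finset.card_le_card fun x hx => ?_) (card_eval_tagPolynomial_le hd
        (ι w.toVector) (ι (w.toVector + (E δ.toVector).1)) (E δ.toVector).2.1
          (E δ.toVector).2.2 ?_)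
      · have hx := (Finset.mem_filter.1 hx).2
        refine Finset.mem_filter.2 ⟨Finset.mem_univ _, ?_⟩
        by_contra hne
        refine hx (if_neg ?_)
        simpa [Bits.toVector_add, enc, Bits.toVector_ofVector, tag] using hne
      · rintro ⟨h1, h2, h3⟩
        have h1 : (E δ.toVector).1 = 0 := by simpa using hι h1
        have h4 : δ.toVector = 0 := by
          rw [← E.map_eq_zero_iff]
          exact Prod.ext h1 (Prod.ext h2 h3)
        obtain ⟨k, hk⟩ := hδ
        have := congrFun h4 k
        simp [Bits.toVector, hk] at this
    have hcast : ((Finset.univ.filter fun c => dec ((enc w c).add δ) ≠ none).card : ℝ) ≤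
        2 ^ Nat.clog 2 m := by exact_mod_cast hle.trans hds
    refine hcast.trans (le_of_eq ?_)
    rw [hcard]
    push_cast
    rw [pow_add, mul_left_comm, ← mul_pow]
    norm_num

/-- For `s > 0`, `d` is the largest odd number below `m`. It satisfies `d + 1 ≤ m`, and `d` field
elements still have room for `m` bits. For `s = 0` any large odd `d` will do. -/
theorem AMDCode.nonempty {m : ℕ} (s : ℕ) (hm : 2 ≤ m) : Nonempty (AMDCode m s) := by
  have h1 : m ≤ 2 ^ Nat.clog 2 m := Nat.le_pow_clog one_lt_two m
  have hpos : 0 < Nat.clog 2 m := Nat.clog_pos one_lt_two hm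
  rcases Nat.eq_zero_or_pos s with rfl | hs
  · exact nonempty_of_odd (d := 2 * m + 1) (by omega) ⟨m, rfl⟩ (by nlinarith) (Or.inl rfl)
  rcases Nat.even_or_odd m with he | ho
  · obtain ⟨c, rfl⟩ := he
    exact nonempty_of_odd (d := c + c - 1) (by omega) ⟨c - 1, by omega⟩
      (by
        obtain ⟨c, rfl⟩ : ∃ b, c = b + 1 := ⟨c - 1, by omega⟩
        rw [show c + 1 + (c + 1) - 1 = 2 * c + 1 by omega]
        nlinarith) (Or.inr (by omega))
  · obtain ⟨c, rfl⟩ := ho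
    have h3 : 2 ≤ Nat.clog 2 (2 * c + 1) := by
      by_contra hlt
      have : Nat.clog 2 (2 * c + 1) = 1 := by omega
      rw [this] at h1
      omega
    exact nonempty_of_odd (d := 2 * c - 1) (by omega) ⟨c - 1, by omega⟩
      (by
        obtain ⟨b, rfl⟩ : ∃ b, c = b + 1 := ⟨c - 1, by omega⟩
        rw [show 2 * (b + 1) - 1 = 2 * b + 1 by omega]
        nlinarith) (Or.inr (by omega))

namespace FixedRole

/-! ### Bits modulo two -/

/-- A bit as an integer modulo two. -/
def toZMod (b : Bool) : ZMod 2 := if b then 1 else 0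

theorem toZMod_injective : Function.Injective toZMod := by
  unfold Function.Injective; decide

theorem toZMod_xor (a b : Bool) : toZMod (xor a b) = toZMod a + toZMod b := by
  revert a b; decide

@[simp] theorem toZMod_false : toZMod false = 0 := rfl

theorem toZMod_ite (p : Prop) [Decidable p] (a b : Bool) :
    toZMod (if p then a else b) = if p then toZMod a else toZMod b := apply_ite _ _ _ _

theorem toZMod_parity {n : ℕ} (f : Fin n → Bool) : toZMod (parity f) = ∑ i, toZMod (f i) := by
  rw [Fin.sum_univ_def, parity]
  induction List.finRange n with
  | nil => rfl
  | cons a l ih => rw [List.foldr_cons, toZMod_xor, ih, List.map_cons, List.sum_cons]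

variable {n m s : ℕ}

/-! ### The schedule -/

theorem mem_roundSteps {k : ℕ} {π : Equiv.Perm (Fin n)} {e : Step n} :
    e ∈ roundSteps k π ↔ e.tag = k ∧ e.dst ≠ some e.src := by
  obtain ⟨src, dst, tag⟩ := e
  cases dst with
  | none =>
    simp only [roundSteps, List.mem_append, List.mem_flatMap, List.mem_map, List.mem_filter,
      List.mem_finRange, true_and, Step.mk.injEq]
    constructor
    · rintro (⟨i, j, -, -, h, -⟩ | ⟨p, -, -, rfl⟩)
      · simp at h
      · simp
    · rintro ⟨rfl, -⟩
      exact Or.inr ⟨π.symm src, by simp⟩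
  | some d =>
    simp only [roundSteps, List.mem_append, List.mem_flatMap, List.mem_map, List.mem_filter,
      List.mem_finRange, true_and, Step.mk.injEq, decide_eq_true_eq]
    constructor
    · rintro (⟨i, j, hj, rfl, h, rfl⟩ | ⟨p, -, h, -⟩)
      · rw [← h]; simpa using hj
      · simp at h
    · rintro ⟨rfl, h⟩
      exact Or.inl ⟨src, d, by simpa using h, rfl, rfl, rfl⟩

theorem nodup_roundSteps (k : ℕ) (π : Equiv.Perm (Fin n)) : (roundSteps k π).Nodup := by
  rw [roundSteps, List.nodup_append]
  refine ⟨?_, ?_, ?_⟩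
  · rw [List.nodup_flatMap]
    refine ⟨fun i _ => ?_, ?_⟩
    · refine List.Nodup.map ?_ ((List.nodup_finRange n).filter _)
      intro a b h
      simpa using h
    · refine (List.nodup_finRange n).imp fun {a b} hab => ?_
      intro x hx hx'
      simp only [List.mem_map] at hx hx'
      obtain ⟨_, _, rfl⟩ := hx
      obtain ⟨_, _, h⟩ := hx'
      exact hab (congrArg Step.src h).symm
  · refine List.Nodup.map ?_ (List.nodup_finRange n)
    intro a b h
    simpa using h
  · rintro a ha b hb rfl
    simp only [List.mem_flatMap, List.mem_map] at ha hb
    obtain ⟨_, _, _, _, rfl⟩ := ha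
    obtain ⟨_, _, h⟩ := hb
    simp at h

theorem countP_roundSteps (k : ℕ) (π : Equiv.Perm (Fin n)) (i : Fin n) (d : Option (Fin n))
    (hd : d ≠ some i) :
    (roundSteps k π).countP (fun e => decide (e.src = i ∧ e.dst = d)) = 1 := by
  rw [← List.count_eq_one_of_mem (nodup_roundSteps k π)
    (mem_roundSteps.2 ⟨rfl, hd⟩ : (⟨i, d, k⟩ : Step n) ∈ roundSteps k π), List.count]
  refine List.countP_congr fun e he => ?_
  have := (mem_roundSteps.1 he).1
  obtain ⟨src, dst, tag⟩ := e
  simp_all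

theorem countP_schedule (ord : Fin n → Equiv.Perm (Fin n)) (i : Fin n) (d : Option (Fin n))
    (hd : d ≠ some i) :
    (schedule m s ord).countP (fun e => decide (e.src = i ∧ e.dst = d)) =
      amdLength m s + n * s := by
  have h := fun k π => countP_roundSteps k π i d hd
  simp only [schedule, List.countP_append, List.countP_flatMap, Function.comp_def, h]
  simp

theorem mem_schedule {ord : Fin n → Equiv.Perm (Fin n)} {e : Step n} :
    e ∈ schedule m s ord ↔ e.tag < rounds n m s ∧ e.dst ≠ some e.src := by
  simp only [schedule, List.mem_append, List.mem_flatMap, mem_roundSteps, List.mem_range,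
    List.mem_finRange, true_and, rounds]
  constructor
  · rintro (⟨k, hk, rfl, h⟩ | ⟨o, q, hq, h', h⟩)
    · exact ⟨by omega, h⟩
    · refine ⟨?_, h⟩
      have : (o.val + 1) * s ≤ n * s := Nat.mul_le_mul_right s o.isLt
      rw [add_mul, one_mul] at this
      omega
  · rintro ⟨hk, h⟩
    by_cases hlt : e.tag < amdLength m s
    · exact Or.inl ⟨_, hlt, rfl, h⟩
    · obtain ⟨r, hr⟩ := Nat.exists_eq_add_of_le (not_lt.1 hlt)
      have hr' : r < n * s := by omega
      have hs : 0 < s := Nat.pos_of_ne_zero fun h => by simp [h] at hr'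
      refine Or.inr ⟨⟨r / s, (Nat.div_lt_iff_lt_mul hs).2 hr'⟩, r % s, Nat.mod_lt _ hs, ?_, h⟩
      have := Nat.div_add_mod' r s
      simp only
      omega

/-- The order of the phases of the protocol. -/
def phase (e : Step n) : ℕ := 2 * e.tag + if e.dst = none then 1 else 0

theorem pairwise_phase_roundSteps (k : ℕ) (π : Equiv.Perm (Fin n)) :
    (roundSteps k π).Pairwise fun a b => phase a ≤ phase b := by
  rw [roundSteps, List.pairwise_append]
  refine ⟨?_, ?_, ?_⟩
  · refine List.pairwise_of_forall_mem_list fun a ha b hb => ?_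
    simp only [List.mem_flatMap, List.mem_map] at ha hb
    obtain ⟨_, _, _, _, rfl⟩ := ha
    obtain ⟨_, _, _, _, rfl⟩ := hb
    simp [phase]
  · rw [List.pairwise_map]
    exact List.pairwise_of_forall fun a b => le_rfl
  · intro a ha b hb
    simp only [List.mem_flatMap, List.mem_map] at ha hb
    obtain ⟨_, _, _, _, rfl⟩ := ha
    obtain ⟨_, _, rfl⟩ := hb
    simp [phase]

theorem phase_le_of_tag_lt {a b : Step n} (h : a.tag < b.tag) : phase a ≤ phase b := by
  simp only [phase]; split_ifs <;> omega

theorem pairwise_phase_schedule (ord : Fin n → Equiv.Perm (Fin n)) :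
    (schedule m s ord).Pairwise fun a b => phase a ≤ phase b := by
  rw [schedule, List.pairwise_append]
  refine ⟨?_, ?_, ?_⟩
  · rw [List.pairwise_flatMap]
    refine ⟨fun k _ => pairwise_phase_roundSteps k _, List.pairwise_lt_range.imp ?_⟩
    intro a b hab x hx y hy
    exact phase_le_of_tag_lt (by rwa [(mem_roundSteps.1 hx).1, (mem_roundSteps.1 hy).1])
  · rw [List.pairwise_flatMap]
    refine ⟨fun o _ => ?_, (List.pairwise_lt_finRange n).imp ?_⟩
    · rw [List.pairwise_flatMap]
      refine ⟨fun k _ => pairwise_phase_roundSteps _ _, List.pairwise_lt_range.imp ?_⟩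
      intro a b hab x hx y hy
      exact phase_le_of_tag_lt (by rw [(mem_roundSteps.1 hx).1, (mem_roundSteps.1 hy).1]; omega)
    · intro a b hab x hx y hy
      simp only [List.mem_flatMap, List.mem_range, mem_roundSteps] at hx hy
      obtain ⟨q, hq, hx, -⟩ := hx
      obtain ⟨r, hr, hy, -⟩ := hy
      refine phase_le_of_tag_lt ?_
      have : (a.val + 1) * s ≤ b.val * s := Nat.mul_le_mul_right s hab
      rw [add_mul, one_mul] at this
      omega
  · intro x hx y hy
    simp only [List.mem_flatMap, List.mem_range, mem_roundSteps] at hx hy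
    obtain ⟨q, hq, hx, -⟩ := hx
    obtain ⟨o, -, r, hr, hy, -⟩ := hy
    exact phase_le_of_tag_lt (by omega)

/-- The schedule is sorted by phase, so whatever belongs to a strictly earlier phase has already
been sent. -/
theorem mem_take_schedule {ord : Fin n → Equiv.Perm (Fin n)} {t : ℕ} {e e' : Step n}
    (he : (schedule m s ord)[t]? = some e) (he' : e'.dst ≠ some e'.src)
    (h : phase e' < phase e) : e' ∈ (schedule m s ord).take t := by
  obtain ⟨ht, rfl⟩ := List.getElem?_eq_some_iff.1 he
  have htag := (mem_schedule.1 (List.getElem_mem ht)).1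
  have hle : e'.tag ≤ (schedule m s ord)[t].tag := by
    by_contra hlt
    exact absurd (phase_le_of_tag_lt (not_le.1 hlt)) (not_le.2 h)
  have hmem : e' ∈ schedule m s ord := mem_schedule.2 ⟨hle.trans_lt htag, he'⟩
  rw [← List.take_append_drop t (schedule m s ord), List.mem_append] at hmem
  refine hmem.resolve_right fun hd => ?_
  have hp := (pairwise_phase_schedule (m := m) (s := s) ord).drop (i := t)
  rw [List.drop_eq_getElem_cons ht] at hd hp
  rcases List.mem_cons.1 hd with rfl | hd
  · exact lt_irrefl _ h
  · exact absurd ((List.pairwise_cons.1 hp).1 _ hd) (not_le.2 h)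

/-! ### The values of the bits -/

/-- The bits are a function of the step, so the first entry found is correct even if steps are
repeated. -/
theorem read_seenBy {l : List (Step n)} (f : Step n → Bool) {C : Finset (Fin n)} {e : Step n}
    (he : e ∈ l) (hC : e.VisibleTo C) :
    read (Transcript.seenBy C (l.map fun e => (e, f e))) e = f e := by
  induction l with
  | nil => simp at he
  | cons a l ih =>
    by_cases ha : a = e
    · subst ha
      simp [read, Transcript.seenBy, hC]
    · have := ih ((List.mem_cons.1 he).resolve_left (Ne.symm ha))
      simp only [read, Transcript.seenBy, List.map_cons] at this ⊢
      rw [List.find?_cons_of_neg (by simpa using ha)]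
      exact this

variable (code : AMDCode m s)

theorem bitAt_of_le {N : ℕ} (f : Bits N) {k : ℕ} (h : N ≤ k) : bitAt f k = false :=
  dif_neg (not_lt.2 h)

theorem bitAt_of_lt {N : ℕ} (f : Bits N) {k : ℕ} (h : k < N) : bitAt f k = f ⟨k, h⟩ :=
  dif_pos h

/-- The input of a player for round `k` of **parity**, if the receiver does not decode `⊥`. -/
def honestInput (ρ : Role m) (c : Coin n code) (k : ℕ) : Bool :=
  match ρ with
  | Role.sender w => bitAt (code.enc w c.enc) k
  | Role.receiver => if k < amdLength m s then bitAt c.pad k else false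
  | Role.bystander => false

/-- Bit `j` of the random string of `i` in round `k`. -/
def honestShare (inp : Fin n → Role m) (ω : Fin n → Coin n code) (k : ℕ) (i j : Fin n) : Bool :=
  share code k i (ω i) (honestInput code (inp i) (ω i) k) j

/-- The bit sent in step `e`, if the receiver does not decode `⊥`. -/
def value (inp : Fin n → Role m) (ω : Fin n → Coin n code) (e : Step n) : Bool :=
  match e.dst with
  | some j => honestShare code inp ω e.tag e.src j
  | none => parity fun l => honestShare code inp ω e.tag l e.src

theorem toZMod_share (k : ℕ) (i : Fin n) (c : Coin n code) (x : Bool) (j : Fin n) :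
    toZMod (share code k i c x j) =
      if j = i then toZMod x + ∑ l, (if l = i then 0 else toZMod (if h : k < rounds n m s then
        c.share ⟨k, h⟩ l else false))
      else toZMod (if h : k < rounds n m s then c.share ⟨k, h⟩ j else false) := by
  rw [share, toZMod_ite, toZMod_xor, toZMod_parity]
  simp only [toZMod_ite, toZMod_false]

theorem add_self_zmod_two (a : ZMod 2) : a + a = 0 := by
  revert a; decide

theorem sum_toZMod_share (k : ℕ) (i : Fin n) (c : Coin n code) (x : Bool) :
    ∑ j, toZMod (share code k i c x j) = toZMod x := by
  have h : ∀ j, toZMod (share code k i c x j) =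
      (if j = i then toZMod x + ∑ l, (if l = i then 0 else toZMod (if h : k < rounds n m s then
        c.share ⟨k, h⟩ l else false)) else 0) +
      (if j = i then 0 else toZMod (if h : k < rounds n m s then c.share ⟨k, h⟩ j else false)) := by
    intro j
    rw [toZMod_share]
    by_cases hj : j = i <;> simp [hj]
  rw [Finset.sum_congr rfl fun j _ => h j, Finset.sum_add_distrib, Finset.sum_ite_eq',
    if_pos (Finset.mem_univ i), add_assoc, add_self_zmod_two, add_zero]

/-- The announced bits are the column sums of the matrix of shares and the inputs are its row sums.
-/
theorem toZMod_outcome {l : List (Step n)} (inp : Fin n → Role m) (ω : Fin n → Coin n code)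
    (C : Finset (Fin n)) (k : ℕ) (hl : ∀ i, (⟨i, none, k⟩ : Step n) ∈ l) :
    toZMod (outcome (Transcript.seenBy C (l.map fun e => (e, value code inp ω e))) k) =
      ∑ i, toZMod (honestInput code (inp i) (ω i) k) := by
  rw [outcome, toZMod_parity]
  have h : ∀ i, read (Transcript.seenBy C (l.map fun e => (e, value code inp ω e))) ⟨i, none, k⟩ =
      value code inp ω ⟨i, none, k⟩ := fun i => read_seenBy _ (hl i) (Or.inl rfl)
  simp only [h]
  simp only [value, toZMod_parity]
  rw [Finset.sum_comm]
  exact Finset.sum_congr rfl fun i _ => sum_toZMod_share code k i (ω i) _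

theorem sum_honestInput {S R : Fin n} (hSR : S ≠ R) (w : Bits m) (ω : Fin n → Coin n code)
    (k : ℕ) :
    ∑ i, toZMod (honestInput code (assign S R w i) (ω i) k) =
      toZMod (bitAt (code.enc w (ω S).enc) k) +
        if k < amdLength m s then toZMod (bitAt (ω R).pad k) else 0 := by
  rw [Finset.sum_eq_add S R hSR]
  · by_cases hk : k < amdLength m s <;> simp [assign, hSR.symm, honestInput, hk]
  · intro i _ hi
    simp [assign, hi.1, hi.2, honestInput]
  · simp
  · simp

theorem decoded_eq {l : List (Step n)} {S R : Fin n} (hSR : S ≠ R) (w : Bits m)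
    (ω : Fin n → Coin n code) (C : Finset (Fin n))
    (hl : ∀ i, ∀ k < amdLength m s, (⟨i, none, k⟩ : Step n) ∈ l) :
    decoded code (ω R)
      (Transcript.seenBy C (l.map fun e => (e, value code (assign S R w) ω e))) = some w := by
  rw [decoded, ← code.dec_enc w (ω S).enc]
  congr 1
  funext k
  apply toZMod_injective
  rw [toZMod_xor, toZMod_outcome code _ _ _ _ fun i => hl i k k.isLt, sum_honestInput code hSR,
    if_pos k.isLt, add_assoc, add_self_zmod_two, add_zero, bitAt_of_lt _ k.isLt]

theorem assign_eq_receiver {S R : Fin n} {w : Bits m} {i : Fin n}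
    (h : assign S R w i = Role.receiver) : i = R := by
  by_contra hne
  by_cases hS : i = S <;> simp [assign, hS, hne] at h

theorem assign_eq_sender {S R : Fin n} {w w' : Bits m} {i : Fin n}
    (h : assign S R w i = Role.sender w') : i = S ∧ w = w' := by
  by_cases hS : i = S
  · simp only [assign, hS, if_true, Role.sender.injEq] at h
    exact ⟨hS, h⟩
  · by_cases hR : i = R <;> simp [assign, hS, hR] at h
    simp_all

/-- This is the induction step of `run_eq`: if all earlier bits are given by `value`, so is the next
one. -/
theorem message_eq_value {ord : Fin n → Equiv.Perm (Fin n)} {S R : Fin n} (hSR : S ≠ R)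
    (w : Bits m) (ω : Fin n → Coin n code) {t : ℕ} {e : Step n}
    (he : (schedule m s ord)[t]? = some e) :
    message code e (assign S R w e.src) (ω e.src) (Transcript.seenBy {e.src}
      (((schedule m s ord).take t).map fun e => (e, value code (assign S R w) ω e))) =
        value code (assign S R w) ω e := by
  set v := Transcript.seenBy {e.src}
      (((schedule m s ord).take t).map fun e => (e, value code (assign S R w) ω e)) with hv
  have hinput : input code e.tag (ω e.src) v (assign S R w e.src) =
      honestInput code (assign S R w e.src) (ω e.src) e.tag := by
    cases hr : assign S R w e.src with
    | sender u => rfl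
    | bystander => rfl
    | receiver =>
      simp only [input, honestInput]
      by_cases hk : e.tag < amdLength m s
      · simp [hk]
      · have := assign_eq_receiver hr
        -- During veto all broadcasts of the code word lie in earlier phases, so the receiver has
        -- already decoded `w`.
        rw [this, hv, decoded_eq code hSR w ω _ fun i k hk' => mem_take_schedule he (by simp) ?_]
        · simp [hk]
        · simp only [phase, if_true]
          split_ifs <;> omega
  obtain ⟨src, dst, tag⟩ := e
  cases dst with
  | some j => simp only [message, value, honestShare, hinput]
  | none =>
    simp only [message, value, hinput]
    congr 1
    funext l
    split_ifs with h
    · subst h; rfl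
    · rw [hv, read_seenBy _ (mem_take_schedule he (by simpa using Ne.symm h) (by simp [phase]))
        (Or.inr (Or.inr ⟨src, by simp, rfl⟩))]
      rfl

/-- The next step depends only on the number of steps so far. Hence this holds for arbitrary inputs,
and so does the count of the communication. -/
theorem map_fst_run (ord : Fin n → Equiv.Perm (Fin n)) (inp : Fin n → Role m)
    (ω : (fixedRoleAMT code ord).Coins) (t : ℕ) :
    ((fixedRoleAMT code ord).run inp ω t).map Prod.fst = (schedule m s ord).take t := by
  induction t with
  | zero => simp [Protocol.run]
  | succ t ih =>
    have hlen : (((fixedRoleAMT code ord).run inp ω t).seenBy ∅).length =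
        min t (schedule m s ord).length := by
      have := congrArg List.length ih
      rw [List.length_map, List.length_take] at this
      rw [Transcript.seenBy, List.length_map, this]
    have hnext : (fixedRoleAMT code ord).next
        (((fixedRoleAMT code ord).run inp ω t).seenBy ∅) = (schedule m s ord)[t]? := by
      change (schedule m s ord)[(((fixedRoleAMT code ord).run inp ω t).seenBy ∅).length]? = _
      rw [hlen]
      rcases le_total t (schedule m s ord).length with h | h
      · rw [min_eq_left h]
      · rw [min_eq_right h, List.getElem?_eq_none le_rfl, List.getElem?_eq_none h]
    rw [List.take_add_one]
    cases hn : (schedule m s ord)[t]? with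
    | none => rw [Protocol.run_succ_of_none _ (hnext.trans hn), ih]; simp
    | some e =>
      rw [Protocol.run_succ_of_some _ (hnext.trans hn), List.map_append, ih]; simp

theorem run_eq (ord : Fin n → Equiv.Perm (Fin n)) {S R : Fin n} (hSR : S ≠ R) (w : Bits m)
    (ω : (fixedRoleAMT code ord).Coins) (t : ℕ) :
    (fixedRoleAMT code ord).run (assign S R w) ω t =
      ((schedule m s ord).take t).map fun e => (e, value code (assign S R w) ω e) := by
  induction t with
  | zero => simp [Protocol.run]
  | succ t ih =>
    have hfst := map_fst_run code ord (assign S R w) ω (t + 1)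
    cases hn : (fixedRoleAMT code ord).next
        (((fixedRoleAMT code ord).run (assign S R w) ω t).seenBy ∅) with
    | none =>
      rw [Protocol.run_succ_of_none _ hn, map_fst_run] at hfst
      rw [Protocol.run_succ_of_none _ hn, ih, hfst]
    | some e =>
      rw [Protocol.run_succ_of_some _ hn, List.map_append, map_fst_run, List.take_add_one] at hfst
      have he : (schedule m s ord)[t]? = some e := by
        have h := List.append_cancel_left hfst
        cases h' : (schedule m s ord)[t]? with
        | none => simp [h'] at h
        | some e' => simpa [h'] using h.symm
      rw [Protocol.run_succ_of_some _ hn, ih, List.take_add_one, he, List.map_append]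
      congr 1
      exact congrArg (fun b => [(e, b)]) (message_eq_value code hSR w ω he)

theorem transcript_eq (ord : Fin n → Equiv.Perm (Fin n)) {S R : Fin n} (hSR : S ≠ R) (w : Bits m)
    (ω : (fixedRoleAMT code ord).Coins) :
    (fixedRoleAMT code ord).transcript (assign S R w) ω =
      (schedule m s ord).map fun e => (e, value code (assign S R w) ω e) := by
  have h := run_eq code ord hSR w ω (schedule m s ord).length
  rw [List.take_length] at h
  exact h

/-! ### Communication and correctness -/

theorem sentBits_transcript (ord : Fin n → Equiv.Perm (Fin n)) (inp : Fin n → Role m)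
    (ω : (fixedRoleAMT code ord).Coins) {i j : Fin n} (hij : i ≠ j) :
    ((fixedRoleAMT code ord).transcript inp ω).sentBits i j =
      2 * (amdLength m s + n * s) := by
  have h := map_fst_run code ord inp ω (schedule m s ord).length
  rw [List.take_length] at h
  have h1 := countP_schedule (m := m) (s := s) ord i (some j) (by simpa using hij.symm)
  have h2 := countP_schedule (m := m) (s := s) ord i none (by simp)
  rw [← h, List.countP_map] at h1 h2
  rw [two_mul]
  exact congrArg₂ (· + ·) h1 h2

theorem output_eq (ord : Fin n → Equiv.Perm (Fin n)) {S R : Fin n} (hSR : S ≠ R) (w : Bits m)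
    (ω : (fixedRoleAMT code ord).Coins) :
    (fixedRoleAMT code ord).output (assign S R w) ω R = some w := by
  have hmem : ∀ i, ∀ k < rounds n m s, (⟨i, none, k⟩ : Step n) ∈ schedule m s ord :=
    fun i k hk => mem_schedule.2 ⟨hk, by simp⟩
  change result code (ω R) (Transcript.seenBy {R} _) = _
  rw [transcript_eq code ord hSR]
  unfold result
  rw [if_neg, decoded_eq code hSR w ω _ fun i k hk =>
    hmem i k (hk.trans_le (Nat.le_add_right _ _))]
  rintro ⟨k, hk, h⟩
  have h1 := toZMod_outcome code (assign S R w) ω {R} (amdLength m s + k)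
    fun i => hmem i _ (Nat.add_lt_add_left hk _)
  rw [h] at h1
  have h2 := h1.trans (sum_honestInput code hSR w ω _)
  -- In veto the index lies beyond the code word, where `bitAt` has the default value `false`.
  rw [bitAt_of_le _ (Nat.le_add_right _ _), if_neg (by omega)] at h2
  exact absurd h2 (by decide)

theorem correctUpTo_zero (ord : Fin n → Equiv.Perm (Fin n)) :
    (fixedRoleAMT code ord).CorrectUpTo 0 := by
  intro S R w hSR
  rw [Protocol.prob_of_forall _ fun ω => output_eq code ord hSR w ω, sub_zero]

end FixedRole

theorem Protocol.prob_le_prob_of_injective {n m : ℕ} (P : Protocol n m) {E F : P.Coins → Prop}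
    (T : P.Coins → P.Coins) (hT : Function.Injective T) (hw : ∀ ω, P.weight (T ω) = P.weight ω)
    (h : ∀ ω, E ω → F (T ω)) : P.prob E ≤ P.prob F := by
  classical
  rw [prob_eq, prob_eq, ← (Finite.injective_iff_bijective.1 hT).sum_comp
    fun ω => P.weight ω * if F ω then 1 else 0]
  refine Finset.sum_le_sum fun ω _ => ?_
  rw [hw]
  refine mul_le_mul_of_nonneg_left ?_ (P.weight_nonneg ω)
  by_cases hE : E ω
  · simp [hE, h ω hE]
  · rw [if_neg hE]
    exact ite_nonneg zero_le_one le_rfl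

namespace FixedRole

variable {n m s : ℕ} (code : AMDCode m s)

theorem xor_right_cancel {a b c : Bool} : xor a c = xor b c → a = b := by
  revert a b c; decide

/-! ### Anonymity -/

/-- The new sender and receiver take over the coins of the old ones, and the random string of the
receiver is adapted to the new message. -/
def exchangeRoles (S R S' R' : Fin n) (w w' : Bits m) (ω : Fin n → Coin n code) :
    Fin n → Coin n code := fun i =>
  { share := (ω i).share
    pad := fun k => xor ((ω (Equiv.swap R R' i)).pad k) (if i = R' then
      xor (bitAt (code.enc w (ω S).enc) k) (bitAt (code.enc w' (ω S).enc) k) else false)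
    enc := (ω (Equiv.swap S S' i)).enc }

/-- The difference between the inputs of player `i` in two situations. -/
def inputDiff (inp inp' : Fin n → Role m) (ω ω' : Fin n → Coin n code) (k : ℕ) (i : Fin n) :
    Bool :=
  xor (honestInput code (inp i) (ω i) k) (honestInput code (inp' i) (ω' i) k)

/-- Every player except `h` changes the bits that he sends to `h` as his inputs change. -/
def changeShares (h : Fin n) (inp inp' : Fin n → Role m) (ω ω' : Fin n → Coin n code) :
    Fin n → Coin n code := fun i =>
  { share := fun k j => xor ((ω' i).share k j)
      (if j = h ∧ i ≠ h then inputDiff code inp inp' ω ω' k i else false)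
    pad := (ω' i).pad
    enc := (ω' i).enc }

/-- The coins that make another situation look the same. -/
def simulate (h S R S' R' : Fin n) (w w' : Bits m) (ω : Fin n → Coin n code) :
    Fin n → Coin n code :=
  changeShares code h (assign S R w) (assign S' R' w') ω (exchangeRoles code S R S' R' w w' ω)

theorem honestInput_congr (ρ : Role m) {c c' : Coin n code} (hp : c.pad = c'.pad)
    (he : c.enc = c'.enc) (k : ℕ) : honestInput code ρ c k = honestInput code ρ c' k := by
  simp only [honestInput, hp, he]

theorem honestInput_changeShares (ρ : Role m) (h : Fin n) (inp inp' : Fin n → Role m)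
    (ω ω' : Fin n → Coin n code) (k : ℕ) (i : Fin n) :
    honestInput code ρ (changeShares code h inp inp' ω ω' i) k = honestInput code ρ (ω' i) k :=
  rfl

theorem exchangeRoles_injective (S R S' R' : Fin n) (w w' : Bits m) :
    Function.Injective (exchangeRoles code S R S' R' w w') := by
  intro a b hab
  have hs : ∀ i, (a i).share = (b i).share := by
    intro i
    have := congrArg Coin.share (congrFun hab i)
    exact this
  have he : ∀ i, (a i).enc = (b i).enc := by
    intro i
    have := congrArg Coin.enc (congrFun hab (Equiv.swap S S' i))
    simpa [exchangeRoles] using this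
  have hp : ∀ i, (a i).pad = (b i).pad := by
    intro i
    funext k
    have := congrFun (congrArg Coin.pad (congrFun hab (Equiv.swap R R' i))) k
    simp only [exchangeRoles, Equiv.swap_apply_self, he S] at this
    exact xor_right_cancel this
  funext i
  have h1 := hs i
  have h2 := hp i
  have h3 := he i
  cases ha : a i; cases hb : b i
  simp_all

/-- `changeShares` keeps pads and encoding coins. These determine the input differences, which can
then be removed from the shares. -/
theorem simulate_injective (h S R S' R' : Fin n) (w w' : Bits m) :
    Function.Injective (simulate code h S R S' R' w w') := by
  intro a b hab
  have he' : ∀ i, (exchangeRoles code S R S' R' w w' a i).enc =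
      (exchangeRoles code S R S' R' w w' b i).enc := by
    intro i
    have := congrArg Coin.enc (congrFun hab i)
    exact this
  have hp' : ∀ i, (exchangeRoles code S R S' R' w w' a i).pad =
      (exchangeRoles code S R S' R' w w' b i).pad := by
    intro i
    have := congrArg Coin.pad (congrFun hab i)
    exact this
  have he : ∀ i, (a i).enc = (b i).enc := by
    intro i
    have := he' (Equiv.swap S S' i)
    simpa [exchangeRoles] using this
  have hp : ∀ i, (a i).pad = (b i).pad := by
    intro i
    funext k
    have := congrFun (hp' (Equiv.swap R R' i)) k
    simp only [exchangeRoles, Equiv.swap_apply_self, he S] at this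
    exact xor_right_cancel this
  have hd : ∀ k i, inputDiff code (assign S R w) (assign S' R' w') a
      (exchangeRoles code S R S' R' w w' a) k i = inputDiff code (assign S R w) (assign S' R' w') b
      (exchangeRoles code S R S' R' w w' b) k i := by
    intro k i
    rw [inputDiff, inputDiff, honestInput_congr code _ (hp i) (he i),
      honestInput_congr code _ (hp' i) (he' i)]
  refine exchangeRoles_injective code S R S' R' w w' (funext fun i => ?_)
  have hs : (exchangeRoles code S R S' R' w w' a i).share =
      (exchangeRoles code S R S' R' w w' b i).share := by
    funext k j
    have := congrFun (congrFun (congrArg Coin.share (congrFun hab i)) k) j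
    simp only [simulate, changeShares, hd] at this
    exact xor_right_cancel this
  have h2 := hp' i
  have h3 := he' i
  cases ha : exchangeRoles code S R S' R' w w' a i
  cases hb : exchangeRoles code S R S' R' w w' b i
  simp_all

/-- For `i ≠ h` the changes of the input and of the bit for `h` cancel in the bit that `i` keeps.
For `i = h` the kept bit is itself the bit for `h` and absorbs the change of the input. Thus only
column `h` changes in either case. -/
theorem toZMod_honestShare_changeShares (h : Fin n) (inp inp' : Fin n → Role m)
    (ω ω' : Fin n → Coin n code) (hs : ∀ i, (ω' i).share = (ω i).share) {k : ℕ}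
    (hk : k < rounds n m s) (i j : Fin n) :
    toZMod (honestShare code inp' (changeShares code h inp inp' ω ω') k i j) =
      toZMod (honestShare code inp ω k i j) +
        if j = h then toZMod (inputDiff code inp inp' ω ω' k i) else 0 := by
  rw [honestShare, honestShare, toZMod_share, toZMod_share, honestInput_changeShares]
  simp only [dif_pos hk, changeShares, hs, toZMod_xor, toZMod_ite, toZMod_false]
  have hx : toZMod (honestInput code (inp' i) (ω' i) k) =
      toZMod (honestInput code (inp i) (ω i) k) + toZMod (inputDiff code inp inp' ω ω' k i) := by
    rw [inputDiff, toZMod_xor, ← add_assoc, add_self_zmod_two, zero_add]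
  rw [hx]
  set d := toZMod (inputDiff code inp inp' ω ω' k i)
  by_cases hih : i = h
  · subst hih
    by_cases hj : j = i
    · simp [hj, add_right_comm]
    · simp [hj]
  · have hsum : (∑ l, if l = i then (0 : ZMod 2) else
        toZMod ((ω i).share ⟨k, hk⟩ l) + if l = h ∧ i ≠ h then d else 0) =
        (∑ l, if l = i then (0 : ZMod 2) else toZMod ((ω i).share ⟨k, hk⟩ l)) + d := by
      have : ∀ l, (if l = i then (0 : ZMod 2) else
          toZMod ((ω i).share ⟨k, hk⟩ l) + if l = h ∧ i ≠ h then d else 0) =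
          (if l = i then (0 : ZMod 2) else toZMod ((ω i).share ⟨k, hk⟩ l)) +
            if l = h then d else 0 := by
        intro l
        by_cases hl : l = i
        · subst hl; simp [hih]
        · simp [hl, hih]
      rw [Finset.sum_congr rfl fun l _ => this l, Finset.sum_add_distrib, Finset.sum_ite_eq',
        if_pos (Finset.mem_univ h)]
    by_cases hj : j = i
    · subst hj
      rw [if_pos rfl, if_pos rfl, if_neg hih, hsum, add_zero]
      linear_combination add_self_zmod_two d
    · simp [hj, hih]

variable {S R S' R' : Fin n} {w w' : Bits m}

/-- Only column `h` changes. Its sum, which `h` broadcasts, is preserved by `hsum`; of its private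
bits `C` reads only those that its own members send, and by `hd` these do not change. -/
theorem toZMod_value_changeShares {C : Finset (Fin n)} {h : Fin n} (hC : h ∉ C)
    {inp inp' : Fin n → Role m} {ω ω' : Fin n → Coin n code}
    (hs : ∀ i, (ω' i).share = (ω i).share)
    (hd : ∀ k, ∀ i ∈ C, inputDiff code inp inp' ω ω' k i = false)
    (hsum : ∀ k < rounds n m s, ∑ i, toZMod (inputDiff code inp inp' ω ω' k i) = 0) {e : Step n}
    (he : e.VisibleTo C) (hk : e.tag < rounds n m s) :
    value code inp' (changeShares code h inp inp' ω ω') e = value code inp ω e := by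
  apply toZMod_injective
  obtain ⟨src, dst, tag⟩ := e
  cases dst with
  | none =>
    simp only [value, toZMod_parity, toZMod_honestShare_changeShares code h inp inp' ω ω' hs hk]
    rw [Finset.sum_add_distrib]
    split_ifs
    · rw [hsum tag hk, add_zero]
    · simp
  | some j =>
    simp only [value, toZMod_honestShare_changeShares code h inp inp' ω ω' hs hk]
    split_ifs with hj
    · subst hj
      have hsrc : src ∈ C := by
        rcases he with he | he | ⟨l, hl, he⟩
        · simp at he
        · exact he
        · simp only [Option.some.injEq] at he
          exact absurd (he ▸ hl) hC
      rw [hd tag src hsrc, toZMod_false, add_zero]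
    · rw [add_zero]

theorem sum_inputDiff_exchangeRoles (hSR : S ≠ R) (hSR' : S' ≠ R') (ω : Fin n → Coin n code)
    {k : ℕ} (hk : k < rounds n m s) :
    ∑ i, toZMod (inputDiff code (assign S R w) (assign S' R' w') ω
      (exchangeRoles code S R S' R' w w' ω) k i) = 0 := by
  simp only [inputDiff, toZMod_xor]
  rw [Finset.sum_add_distrib, sum_honestInput code hSR, sum_honestInput code hSR']
  simp only [bitAt_of_lt _ hk]
  simp only [exchangeRoles, Equiv.swap_apply_right, if_true, toZMod_xor]
  by_cases hlt : k < amdLength m s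
  · simp only [hlt, if_true]
    -- Both code words and the old pad occur twice: the new pad was chosen to compensate for the
    -- change of the code word.
    linear_combination add_self_zmod_two (toZMod (bitAt (code.enc w (ω S).enc) k)) +
      add_self_zmod_two (toZMod (bitAt (code.enc w' (ω S).enc) k)) +
      add_self_zmod_two (toZMod ((ω R).pad ⟨k, hk⟩))
  · simp [hlt, bitAt_of_le _ (not_lt.1 hlt)]

theorem exchangeRoles_apply {C : Finset (Fin n)}
    (hC : ∀ i ∈ C, assign S R w i = assign S' R' w' i) (hR : R ∈ C → w = w') (hSR : S ≠ R)
    (hSR' : S' ≠ R') (ω : Fin n → Coin n code) {i : Fin n} (hi : i ∈ C) :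
    exchangeRoles code S R S' R' w w' ω i = ω i := by
  have hS : Equiv.swap S S' i = i := by
    by_cases h1 : i = S
    · subst h1
      have := assign_eq_sender ((hC i hi).symm.trans (by simp [assign] : _ = Role.sender w))
      rw [this.1, Equiv.swap_self]; rfl
    · by_cases h2 : i = S'
      · exact absurd (assign_eq_sender ((hC i hi).trans
          (by simp [assign, h2] : _ = Role.sender w'))).1 h1
      · exact Equiv.swap_apply_of_ne_of_ne h1 h2
  have hR' : Equiv.swap R R' i = i ∧ (i = R' → w = w') := by
    by_cases h1 : i = R
    · subst h1
      have := assign_eq_receiver ((hC i hi).symm.trans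
        (by simp [assign, hSR.symm] : _ = Role.receiver))
      refine ⟨?_, fun _ => hR hi⟩
      rw [← this, Equiv.swap_self]; rfl
    · have h2 : i ≠ R' := fun h2 => h1 (assign_eq_receiver ((hC i hi).trans
        (by simp [assign, h2, hSR'.symm])))
      exact ⟨Equiv.swap_apply_of_ne_of_ne h1 h2, fun h => absurd h h2⟩
  have hp : (exchangeRoles code S R S' R' w w' ω i).pad = (ω i).pad := by
    funext k
    simp only [exchangeRoles, hR'.1]
    by_cases h : i = R'
    · simp [h, hR'.2 h]
    · simp [h]
  have he : (exchangeRoles code S R S' R' w w' ω i).enc = (ω i).enc := by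
    simp only [exchangeRoles, hS]
  have hs : (exchangeRoles code S R S' R' w w' ω i).share = (ω i).share := rfl
  cases ha : exchangeRoles code S R S' R' w w' ω i
  cases hb : ω i
  simp_all

theorem inputDiff_exchangeRoles {C : Finset (Fin n)}
    (hC : ∀ i ∈ C, assign S R w i = assign S' R' w' i) (hR : R ∈ C → w = w') (hSR : S ≠ R)
    (hSR' : S' ≠ R') (ω : Fin n → Coin n code) (k : ℕ) {i : Fin n} (hi : i ∈ C) :
    inputDiff code (assign S R w) (assign S' R' w') ω
      (exchangeRoles code S R S' R' w w' ω) k i = false := by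
  rw [inputDiff, exchangeRoles_apply code hC hR hSR hSR' ω hi, hC i hi, Bool.xor_self]

theorem simulate_apply {C : Finset (Fin n)} (h : Fin n)
    (hC : ∀ i ∈ C, assign S R w i = assign S' R' w' i) (hR : R ∈ C → w = w') (hSR : S ≠ R)
    (hSR' : S' ≠ R') (ω : Fin n → Coin n code) {i : Fin n} (hi : i ∈ C) :
    simulate code h S R S' R' w w' ω i = ω i := by
  simp only [simulate, changeShares, inputDiff_exchangeRoles code hC hR hSR hSR' ω _ hi,
    exchangeRoles_apply code hC hR hSR hSR' ω hi, ite_self, Bool.xor_false]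

theorem weight_fixedRoleAMT (ord : Fin n → Equiv.Perm (Fin n))
    (ω ω' : (fixedRoleAMT code ord).Coins) :
    (fixedRoleAMT code ord).weight ω = (fixedRoleAMT code ord).weight ω' :=
  Finset.prod_congr rfl fun i _ => congrArg ENNReal.toReal
    ((PMF.uniformOfFintype_apply (α := Coin n code) (ω i)).trans
      (PMF.uniformOfFintype_apply (α := Coin n code) (ω' i)).symm)

theorem prob_view_le (ord : Fin n → Equiv.Perm (Fin n)) {C : Finset (Fin n)} (hSR : S ≠ R)
    (hSR' : S' ≠ R') (hC : ∀ i ∈ C, assign S R w i = assign S' R' w' i) (hR : R ∈ C → w = w')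
    (c : (fixedRoleAMT code ord).Coins) (v : Seen n) :
    ((fixedRoleAMT code ord).prob fun ω => (∀ i ∈ C, ω i = c i) ∧
        ((fixedRoleAMT code ord).transcript (assign S R w) ω).seenBy C = v) ≤
      (fixedRoleAMT code ord).prob fun ω => (∀ i ∈ C, ω i = c i) ∧
        ((fixedRoleAMT code ord).transcript (assign S' R' w') ω).seenBy C = v := by
  -- If nobody is outside `C`, all inputs agree; otherwise some `h` outside `C` can absorb the
  -- changes.
  by_cases hall : ∀ h, h ∈ C
  · rw [show assign S R w = assign S' R' w' from funext fun i => hC i (hall i)]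
  push Not at hall
  obtain ⟨h, hh⟩ := hall
  refine Protocol.prob_le_prob_of_injective _ (simulate code h S R S' R' w w')
    (simulate_injective code h S R S' R' w w') (fun ω => weight_fixedRoleAMT code ord _ _) ?_
  rintro ω ⟨hc, hv⟩
  refine ⟨fun i hi => (simulate_apply code h hC hR hSR hSR' ω hi).trans (hc i hi), ?_⟩
  rw [← hv, transcript_eq code ord hSR]
  refine (congrArg (Transcript.seenBy C) (transcript_eq code ord hSR' w' _)).trans ?_
  simp only [Transcript.seenBy, List.map_map]
  refine List.map_congr_left fun e he => ?_
  by_cases hvis : e.VisibleTo C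
  · have := toZMod_value_changeShares code hh (inp := assign S R w) (inp' := assign S' R' w')
      (ω := ω) (ω' := exchangeRoles code S R S' R' w w' ω) (fun i => rfl)
      (fun k i hi => inputDiff_exchangeRoles code hC hR hSR hSR' ω k hi)
      (fun k hk => sum_inputDiff_exchangeRoles code hSR hSR' ω hk) hvis (mem_schedule.1 he).1
    simp only [Function.comp_apply, hvis, if_true]
    exact congrArg (fun b => (e, some b)) this
  · simp [hvis]

theorem anonymous (ord : Fin n → Equiv.Perm (Fin n)) : (fixedRoleAMT code ord).Anonymous := by
  intro C S R S' R' w w' hSR hSR' hC hR c v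
  refine le_antisymm (prob_view_le code ord hSR hSR' hC hR c v)
    (prob_view_le code ord hSR' hSR (fun i hi => (hC i hi).symm) (fun hi => ?_) c v)
  have := assign_eq_receiver ((hC R' hi).trans (by simp [assign, hSR'.symm]))
  exact (hR (this ▸ hi)).symm

end FixedRole

/-! ### Asymptotic optimality -/

/-- The crude bounds `Nat.clog 2 m ≤ m`, `n * s ≤ m * s` and `s ≤ m * s` suffice. -/
theorem two_mul_rounds_le {n m : ℕ} (s : ℕ) (hm : m ≠ 0) (h : n ≤ m) :
    2 * (amdLength m s + n * s) ≤ (6 + 6 * s) * m := by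
  have h1 : Nat.clog 2 m ≤ m := Nat.clog_le_of_le_pow Nat.lt_two_pow_self.le
  have h2 : n * s ≤ m * s := Nat.mul_le_mul_right s h
  have h3 : s ≤ m * s := Nat.le_mul_of_pos_left s (Nat.pos_of_ne_zero hm)
  rw [amdLength]
  nlinarith

/-- Markov's inequality bounds the expected traffic of each pair. The sum runs over ordered pairs
and counts every channel twice, hence the factor `2`. -/
theorem Protocol.Anonymous.le_expect_totalPrivate {n m : ℕ} {P : Protocol n m}
    (hP : P.Anonymous) {ε : ℝ} (hc : P.CorrectUpTo ε) {S R : Fin n} (hSR : S ≠ R) (w : Bits m) :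
    (n : ℝ) * ((n : ℝ) - 1) * ((1 - 2 * ε) * m) ≤
      2 * P.expect fun ω => ((P.transcript (assign S R w) ω).totalPrivate : ℝ) := by
  have hpair : ∀ i j, i ≠ j → (1 - 2 * ε) * m ≤ P.expect fun ω =>
      (((P.transcript (assign S R w) ω).privateBits i j : ℝ) +
        (P.transcript (assign S R w) ω).privateBits j i) := by
    intro i j hij
    refine le_trans ?_ (P.mul_prob_le_expect m _ fun ω => by positivity)
    rw [mul_comm]
    refine mul_le_mul_of_nonneg_left ((hP.le_prob_exchanged hc w hSR hij).trans ?_)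
      (Nat.cast_nonneg m)
    exact P.prob_mono fun ω hω => by exact_mod_cast hω
  have hsymm : ∀ ω, (2 : ℝ) * ((P.transcript (assign S R w) ω).totalPrivate : ℝ) =
      ∑ i, ∑ j ∈ Finset.univ.erase i, (((P.transcript (assign S R w) ω).privateBits i j : ℝ) +
        (P.transcript (assign S R w) ω).privateBits j i) := by
    intro ω
    have hcomm : (∑ i, ∑ j ∈ Finset.univ.erase i,
        ((P.transcript (assign S R w) ω).privateBits j i : ℝ)) =
        ∑ i, ∑ j ∈ Finset.univ.erase i,
          ((P.transcript (assign S R w) ω).privateBits i j : ℝ) := by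
      refine Finset.sum_comm' fun x y => ?_
      simp [eq_comm]
    simp only [Finset.sum_add_distrib, hcomm, Transcript.totalPrivate]
    push_cast
    ring
  have hexp : 2 * (P.expect fun ω => ((P.transcript (assign S R w) ω).totalPrivate : ℝ)) =
      ∑ i, ∑ j ∈ Finset.univ.erase i, P.expect fun ω =>
        (((P.transcript (assign S R w) ω).privateBits i j : ℝ) +
          (P.transcript (assign S R w) ω).privateBits j i) := by
    simp only [expect]
    rw [Finset.mul_sum]
    simp only [mul_left_comm (2 : ℝ), hsymm, Finset.mul_sum]
    rw [Finset.sum_comm]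
    exact Finset.sum_congr rfl fun i _ => Finset.sum_comm
  rw [hexp]
  calc (n : ℝ) * ((n : ℝ) - 1) * ((1 - 2 * ε) * m)
      = ∑ i : Fin n, ∑ _j ∈ Finset.univ.erase i, (1 - 2 * ε) * m := by
        have : ((n - 1 : ℕ) : ℝ) = n - 1 := by
          rw [Nat.cast_sub (by have := S.isLt; omega), Nat.cast_one]
        simp [Finset.card_erase_of_mem, this, mul_assoc]
    _ ≤ _ := Finset.sum_le_sum fun i _ => Finset.sum_le_sum fun j hj =>
        hpair i j (Finset.ne_of_mem_erase hj).symm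

theorem FixedRole.totalSent_transcript {n m s : ℕ} (code : AMDCode m s)
    (ord : Fin n → Equiv.Perm (Fin n)) (inp : Fin n → Role m)
    (ω : (fixedRoleAMT code ord).Coins) :
    ((fixedRoleAMT code ord).transcript inp ω).totalSent =
      n * ((n - 1) * (2 * (amdLength m s + n * s))) := by
  have h : ∀ i, ∀ j ∈ Finset.univ.erase i,
      ((fixedRoleAMT code ord).transcript inp ω).sentBits i j =
        2 * (amdLength m s + n * s) := fun i j hj =>
    sentBits_transcript code ord inp ω (Finset.ne_of_mem_erase hj).symm
  rw [Transcript.totalSent, Finset.sum_congr rfl fun i _ => Finset.sum_congr rfl (h i)]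
  simp [Finset.card_erase_of_mem]

theorem mainTheorem5 :
    -- Lower bound: in any anonymous protocol, any two players exchange at least one private bit
    -- per bit of the message.
    (∀ (n m : ℕ) (Q : Protocol n m) (ε : ℝ), Q.CorrectUpTo ε → Q.Anonymous →
      ∀ (S R : Fin n) (w : Bits m), S ≠ R → ∀ i j : Fin n, i ≠ j →
        1 - 2 * ε ≤ Q.prob fun ω =>
          m ≤ (Q.transcript (assign S R w) ω).privateBits i j +
            (Q.transcript (assign S R w) ω).privateBits j i) ∧
    -- The required codes exist.
    (∀ m s : ℕ, 2 ≤ m → Nonempty (AMDCode m s)) ∧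
    -- The protocol is correct and anonymous, and its exact communication.
    (∀ (n m s : ℕ) (code : AMDCode m s) (ord : Fin n → Equiv.Perm (Fin n)), DistinctLast ord →
      (fixedRoleAMT code ord).CorrectUpTo 0 ∧ (fixedRoleAMT code ord).Anonymous ∧
      ∀ (inp : Fin n → Role m) (ω : (fixedRoleAMT code ord).Coins) (i j : Fin n), i ≠ j →
        ((fixedRoleAMT code ord).transcript inp ω).sentBits i j =
          2 * (amdLength m s + n * s)) ∧
    -- Upper bound: for fixed `s`, it uses `O(1)` bits per pair of players per bit of the message.
    (∀ s : ℕ, ∃ K : ℕ, ∀ (n m : ℕ), 2 ≤ n → n ≤ m →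
      ∀ (code : AMDCode m s) (ord : Fin n → Equiv.Perm (Fin n)), DistinctLast ord →
      ∀ (inp : Fin n → Role m) (ω : (fixedRoleAMT code ord).Coins) (i j : Fin n), i ≠ j →
        ((fixedRoleAMT code ord).transcript inp ω).sentBits i j ≤ K * m) ∧
    -- Asymptotic optimality: for fixed `s`, it uses at most a constant times the communication of
    -- any other anonymous protocol, even if the broadcasts of the latter are free.
    (∀ (s : ℕ) (ε : ℝ), ε < 1 / 2 → ∃ K : ℝ, ∀ (n m : ℕ), 2 ≤ n → n ≤ m →
      ∀ (code : AMDCode m s) (ord : Fin n → Equiv.Perm (Fin n)), DistinctLast ord →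
      ∀ Q : Protocol n m, Q.CorrectUpTo ε → Q.Anonymous →
      ∀ (S R : Fin n) (w : Bits m), S ≠ R →
      ∀ ω : (fixedRoleAMT code ord).Coins,
        (((fixedRoleAMT code ord).transcript (assign S R w) ω).totalSent : ℝ) ≤
          K * Q.expect fun ω' => ((Q.transcript (assign S R w) ω').totalPrivate : ℝ)) := by
  refine ⟨fun n m Q ε hc hQ S R w hSR i j hij => hQ.le_prob_exchanged hc w hSR hij,
    fun m s hm => AMDCode.nonempty s hm,
    fun n m s code ord _ => ⟨FixedRole.correctUpTo_zero code ord, FixedRole.anonymous code ord,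
      fun inp ω i j hij => FixedRole.sentBits_transcript code ord inp ω hij⟩,
    fun s => ⟨6 + 6 * s, fun n m hn hnm code ord _ inp ω i j hij => ?_⟩,
    -- The quotient of the upper bound `n * (n - 1) * (6 + 6 * s) * m` by the lower bound `n * (n -
    -- 1) * (1 - 2 * ε) * m / 2`.
    fun s ε hε => ⟨2 * (6 + 6 * s) / (1 - 2 * ε),
      fun n m hn hnm code ord _ Q hc hQ S R w hSR ω => ?_⟩⟩
  · rw [FixedRole.sentBits_transcript code ord inp ω hij]
    exact two_mul_rounds_le s (by omega) hnm
  · have hlow := hQ.le_expect_totalPrivate hc hSR w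
    have hpos : 0 < 1 - 2 * ε := by linarith
    have hup : ((n * ((n - 1) * (2 * (amdLength m s + n * s))) : ℕ) : ℝ) ≤
        (n * ((n - 1) * ((6 + 6 * s) * m)) : ℕ) := by
      have := two_mul_rounds_le s (by omega) hnm
      exact_mod_cast Nat.mul_le_mul_left n (Nat.mul_le_mul_left (n - 1) this)
    rw [FixedRole.totalSent_transcript]
    refine hup.trans ?_
    rw [div_mul_eq_mul_div, le_div_iff₀ hpos]
    have hcast : ((n - 1 : ℕ) : ℝ) = n - 1 := by rw [Nat.cast_sub (by omega), Nat.cast_one]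
    have hs : (0 : ℝ) ≤ 6 + 6 * s := by positivity
    push_cast
    rw [hcast]
    nlinarith [mul_le_mul_of_nonneg_left hlow hs]
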